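/- Let $n\ge 3$. Let $\widetilde\Delta$ be a finite disjoint union of oriented Euclidean $n$-simplices, and let $\Phi$ be a family of orientation-reversing affine isomorphisms (face pairings), closed under inverses, that pairs the $(n-1)$-dimensional faces (facets) of $\widetilde\Delta$, each facet $\tau$ being paired with a facet different from $\tau$ by a unique $\varphi_\tau\in\Phi$ with domain $\tau$. Let $\widehat M=\widetilde\Delta/\Phi$ be the quotient pseudo-manifold, $p:\widetilde\Delta\to\widehat M$ the quotient map, and assume that $\widehat M$ is connected. The image under $p$ of a $k$-simplex is called a $k$-singlex; the $0$-singlexes are the vertices of the triangulation, and $M$ is the complement of the set of vertices in $\widehat M$. The triangulation is called even if every $(n-2)$-singlex $\tau$ has even degree, i.e. the number of $(n-2)$-simplices of $\widetilde\Delta$ mapped onto $\tau$ is even. Crossing a facet $\tau$ of an $n$-simplex $\sigma$ into the $n$-simplex $\sigma'$ containing $\varphi_\tau(\tau)$ defines a bijection from the vertices of $\sigma$ to those of $\sigma'$ (a perspectivity), equal to $\varphi_\tau$ on the vertices of $\tau$ and sending the vertex opposite $\tau$ to the vertex opposite $\varphi_\tau(\tau)$. For a path $\gamma$ in the dual graph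 (the graph in $M$ with one vertex at the barycentre of each $n$-simplex and one edge crossing each pair of identified facets), the projectivity $p_\gamma$ is the composite of the perspectivities of the facets that $\gamma$ crosses in succession. Fix an $n$-simplex $\sigma_0$, and let $x_0\in M$ be the image of its barycentre. (1) If the vertices $v$ and $v'$ of $\sigma_0$ have the same image in $\widehat M$, then there is a loop $\gamma$ in the dual graph based at $x_0$, which may be chosen constant or without backtracking (it never leaves an $n$-simplex through the facet by which it has just entered), so a class $[\gamma]\in\pi_1(M,x_0)$, with $p_\gamma(v)=v'$. (2) Suppose that the triangulation is even and has fewer than $n+1$ vertices. If $n\ge4$, suppose moreover that $p$ is injective on the relative interior of each face of each $n$-simplex, and that for $1\le k\le n-3$ the link of each $k$-singlex is simply connected (as is the case if the triangulation restricts to a combinatorial manifold structure on $M$). Then there is a unique homomorphism $\rho:\pi_1(M,x_0)\to\mathrm{Sym}(\sigma_0)$, the canonical symmetric representation, with $\rho([\gamma])=p_\gamma$ for every loop $\gamma$ in the dual graph based at $x_0$; the image of $\rho$ is non-trivial, and hence $\pi_1(M,x_0)$ is non-trivial. Here the link of a singlex $\tau$ is the boundary of a small normal slice to $\tau$ at its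 barycentre: it is made of one copy of the face opposite to $F$ in the $n$-simplex containing $F$, for each simplex $F$ of $\widetilde\Delta$ mapped onto $\tau$, glued as in $\widehat M$. -/

import Mathlib

noncomputable section

/-- An oriented singular triangulation of a closed `n`-dimensional pseudo-manifold: a family, indexed
by `ι`, of oriented `n`-simplices, each with vertex set `Fin (n + 1)`, together with
orientation-reversing affine isomorphisms pairing their facets.

The facet of the simplex `s` opposite to its vertex `i` is denoted `(s, i)`. It is paired with the
facet `(adj s i, glue s i i)` by the affine isomorphism sending the vertex `j ≠ i` of `s` to the
vertex `glue s i j` of `adj s i`. The permutation `glue s i` moreover sends the vertex `i`, opposite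
to the first facet, to the vertex opposite to the second one, so that it is the vertex map of the
*perspectivity* `s → adj s i` defined by the facet `(s, i)`. -/
structure SingularTriangulation (n : ℕ) (ι : Type*) where
  /-- the orientation of each simplex, relative to the order of its vertices -/
  orientation : ι → ℤˣ
  /-- the simplex on the other side of the facet `(s, i)` -/
  adj : ι → Fin (n + 1) → ι
  /-- the vertex map of the face pairing with domain `(s, i)`, extended to the opposite vertices -/
  glue : ι → Fin (n + 1) → Equiv.Perm (Fin (n + 1))
  /-- the face pairings come in inverse pairs -/
  adj_adj : ∀ s i, adj (adj s i) (glue s i i) = s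
  glue_glue : ∀ s i, glue (adj s i) (glue s i i) = (glue s i)⁻¹
  /-- no facet is paired with itself -/
  pair_ne : ∀ s i, (adj s i, glue s i i) ≠ (s, i)
  /-- The face pairing reverses the induced orientations of the facets; equivalently its extension
  to opposite vertices reverses the orientations of the `n`-simplices. -/
  orientation_adj : ∀ s i,
    orientation (adj s i) * Equiv.Perm.sign (glue s i) = -orientation s

namespace SingularTriangulation

variable {n : ℕ} {ι : Type*} (T : SingularTriangulation n ι)

/-- The disjoint union of the `n`-simplices. -/
abbrev Simplices (_ : SingularTriangulation n ι) : Type _ :=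
  (_ : ι) × stdSimplex ℝ (Fin (n + 1))

/-- `T.Rel a b`: the point `a` lies on a facet, and the face pairing of that facet maps `a` to `b`. -/
def Rel (a b : T.Simplices) : Prop :=
  ∃ i, a.2 i = 0 ∧ b.1 = T.adj a.1 i ∧ ∀ j, b.2 (T.glue a.1 i j) = a.2 j

/-- The closed pseudo-manifold `M̂`: the quotient of the disjoint union of the simplices by the face
pairings, with the quotient topology. -/
def Space : Type _ := Quot T.Rel

instance : TopologicalSpace T.Space := inferInstanceAs (TopologicalSpace (Quot T.Rel))

/-- The quotient map. -/
def proj (a : T.Simplices) : T.Space := Quot.mk T.Rel a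

lemma continuous_proj : Continuous T.proj := continuous_quot_mk

/-- The closed face of the simplex `s` spanned by the set `F` of its vertices. -/
def face (s : ι) (F : Finset (Fin (n + 1))) : Set T.Simplices :=
  {a | a.1 = s ∧ ∀ i ∉ F, a.2 i = 0}

/-- The singlex which is the image of the face of `s` spanned by `F`. -/
def singlex (s : ι) (F : Finset (Fin (n + 1))) : Set T.Space := T.proj '' T.face s F

/-- The image of the `k`-skeleton. -/
def skeleton (k : ℕ) : Set T.Space :=
  ⋃ (s : ι) (F : Finset (Fin (n + 1))) (_ : F.card = k + 1), T.singlex s F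

/-- The degree of the singlex which is the image of the face of `s` spanned by `F`: the number of
faces of the `n`-simplices that are mapped onto it. -/
def degree (s : ι) (F : Finset (Fin (n + 1))) : ℕ :=
  Set.ncard {f : ι × Finset (Fin (n + 1)) | T.singlex f.1 f.2 = T.singlex s F}

/-- The triangulation is even if every `(n-2)`-singlex has even degree. -/
def IsEven : Prop :=
  ∀ (s : ι) (F : Finset (Fin (n + 1))), F.card + 1 = n → Even (T.degree s F)

/-- The quotient map is injective on the relative interior of each face of each simplex (the relative
interior of a face consists of the points whose nonzero barycentric coordinates are precisely
those belonging to the vertices of the face). -/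
def InjectiveOnInteriors : Prop :=
  ∀ (s : ι) (x y : stdSimplex ℝ (Fin (n + 1))), (∀ i, x i = 0 ↔ y i = 0) →
    T.proj ⟨s, x⟩ = T.proj ⟨s, y⟩ → x = y

/-- The link of a singlex `τ` (the image of the face of `s` spanned by `F`), as the boundary of a
normal slice at the barycentre of `τ`. In each `n`-simplex with a face `F'` mapped onto `τ` one takes
the points whose barycentric coordinates at the vertices of `F'` are all equal, with total weight
`n / (n + 1)`. They form a copy of the face opposite to `F'`. Since the remaining total weight
`1 / (n + 1)` is less than each coordinate on `F'` whenever `F` has fewer than `n` vertices,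
slices for different faces of the same simplex are then disjoint. -/
def link (s : ι) (F : Finset (Fin (n + 1))) : Set T.Space :=
  T.proj '' {a | ∃ F' : Finset (Fin (n + 1)), T.singlex a.1 F' = T.singlex s F ∧
    ∀ i ∈ F', a.2 i = (n / (n + 1) : ℝ) / F'.card}

/-- For `1 ≤ k ≤ n - 3`, the link of every `k`-singlex is simply connected. -/
def LinksSimplyConnected : Prop :=
  ∀ (s : ι) (F : Finset (Fin (n + 1))), 2 ≤ F.card → F.card + 2 ≤ n →
    SimplyConnectedSpace (T.link s F)

/-! ### Facet paths and projectivities -/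

/-- Paths in the dual graph from the simplex `s` to the simplex `t`, recorded as the sequence of
facets which are crossed: `cons s i γ` first crosses the facet `(s, i)` and then follows `γ`. -/
inductive FacetPath : ι → ι → Type _
  | nil (s : ι) : FacetPath s s
  | cons {t : ι} (s : ι) (i : Fin (n + 1)) (γ : FacetPath (T.adj s i) t) : FacetPath s t

namespace FacetPath

variable {T}

/-- The projectivity of a facet path: the composite of the perspectivities of the facets crossed, as
a map from the vertices of the first simplex to the vertices of the last one. -/
def projectivity : {s t : ι} → T.FacetPath s t → Equiv.Perm (Fin (n + 1))
  | _, _, nil _ => 1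
  | _, _, cons s i γ => γ.projectivity * T.glue s i

/-- The first facet crossed by the facet path is the one opposite to `i`. -/
def StartsAt : {s t : ι} → T.FacetPath s t → Fin (n + 1) → Prop
  | _, _, nil _, _ => False
  | _, _, cons _ j _, i => j = i

/-- No backtracking: each simplex on the way is entered and left through distinct facets. -/
def IsReduced : {s t : ι} → T.FacetPath s t → Prop
  | _, _, nil _ => True
  | _, _, cons s i γ => ¬ γ.StartsAt (T.glue s i i) ∧ γ.IsReduced

end FacetPath

/-! ### The complement of the vertices and the dual graph in it -/

/-- The complement `M` of the set of vertices in the pseudo-manifold `M̂`. -/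
abbrev Punctured : Type _ := ((T.skeleton 0)ᶜ : Set T.Space)

lemma exists_eq_one_of_mem_skeleton_zero {a : T.Simplices} (h : T.proj a ∈ T.skeleton 0) :
    ∃ j, a.2 j = 1 := by
  have key : ∀ a b : T.Simplices, T.Rel a b → (∃ j, a.2 j = 1) = (∃ j, b.2 j = 1) := by
    rintro a b ⟨i, -, -, hb⟩
    refine propext ⟨?_, ?_⟩
    · rintro ⟨j, hj⟩
      exact ⟨T.glue a.1 i j, (hb j).trans hj⟩
    · rintro ⟨j, hj⟩
      refine ⟨(T.glue a.1 i).symm j, ?_⟩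
      rw [← hb, Equiv.apply_symm_apply, hj]
  simp only [skeleton, Set.mem_iUnion] at h
  obtain ⟨s, F, hF, b, ⟨-, hb⟩, hab⟩ := h
  have h1 : ∃ j, b.2 j = 1 := by
    obtain ⟨j, rfl⟩ := Finset.card_eq_one.mp hF
    refine ⟨j, ?_⟩
    rw [← stdSimplex.sum_eq_one b.2]
    refine (Finset.sum_eq_single j (fun k _ hk => hb k ?_) (by simp)).symm
    simpa using hk
  have h2 : Quot.lift _ key (T.proj b) := h1
  rw [hab] at h2
  exact h2

/-- The barycentre of the facet opposite to the vertex `i`. -/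
def facetBarycenter (hn : 3 ≤ n) (i : Fin (n + 1)) : stdSimplex ℝ (Fin (n + 1)) :=
  ⟨fun j => if j = i then 0 else (n : ℝ)⁻¹, by
    refine ⟨fun j => ?_, ?_⟩
    · dsimp only
      split_ifs <;> positivity
    · have : (n : ℝ) ≠ 0 := by positivity
      simp [Finset.sum_ite, Finset.filter_ne', this]⟩

/-- The point at time `t` on the straight segment from the barycentre of the standard simplex to the
barycentre of its facet opposite to `i`. -/
def spoke (hn : 3 ≤ n) (i : Fin (n + 1)) (t : unitInterval) : stdSimplex ℝ (Fin (n + 1)) :=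
  ⟨AffineMap.lineMap (stdSimplex.barycenter : stdSimplex ℝ (Fin (n + 1))).1
      (facetBarycenter hn i).1 (t : ℝ),
    (convex_stdSimplex ℝ (Fin (n + 1))).lineMap_mem (stdSimplex.barycenter).2
      (facetBarycenter hn i).2 t.2⟩

lemma spoke_zero (hn : 3 ≤ n) (i : Fin (n + 1)) : spoke hn i 0 = stdSimplex.barycenter := by
  apply Subtype.ext
  simp [spoke]

lemma spoke_one (hn : 3 ≤ n) (i : Fin (n + 1)) : spoke hn i 1 = facetBarycenter hn i := by
  apply Subtype.ext
  simp [spoke]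

lemma continuous_spoke (hn : 3 ≤ n) (i : Fin (n + 1)) : Continuous (spoke hn i) := by
  refine Continuous.subtype_mk ?_ _
  exact AffineMap.lineMap_continuous.comp continuous_subtype_val

lemma proj_spoke_notMem (hn : 3 ≤ n) (s : ι) (i : Fin (n + 1)) (t : unitInterval) :
    T.proj ⟨s, spoke hn i t⟩ ∈ (T.skeleton 0)ᶜ := by
  intro h
  obtain ⟨j, hj⟩ := T.exists_eq_one_of_mem_skeleton_zero h
  have hn' : (3 : ℝ) ≤ n := by exact_mod_cast hn
  have e : spoke hn i t j
      = (1 - (t : ℝ)) * ((n : ℝ) + 1)⁻¹ + t * (if j = i then 0 else (n : ℝ)⁻¹) := by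
    change (AffineMap.lineMap (stdSimplex.barycenter : stdSimplex ℝ (Fin (n + 1))).1
      (facetBarycenter hn i).1 (t : ℝ)) j = _
    simp [AffineMap.lineMap_apply_module, facetBarycenter]
  have h1 : ((n : ℝ) + 1)⁻¹ ≤ 1 / 3 := by
    rw [inv_le_comm₀ (by positivity) (by norm_num)]; norm_num; linarith
  have h2 : (if j = i then 0 else (n : ℝ)⁻¹) ≤ 1 / 3 := by
    split_ifs
    · norm_num
    · rw [inv_le_comm₀ (by positivity) (by norm_num)]; norm_num; linarith
  have ht0 := t.2.1
  have ht1 := t.2.2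
  have hj' : spoke hn i t j = 1 := hj
  rw [e] at hj'
  nlinarith [mul_le_mul_of_nonneg_left h1 (sub_nonneg.mpr ht1), mul_le_mul_of_nonneg_left h2 ht0]

/-- The image in `M` of the barycentre of the simplex `s`. -/
def center (hn : 3 ≤ n) (s : ι) : T.Punctured :=
  ⟨T.proj ⟨s, stdSimplex.barycenter⟩, spoke_zero hn 0 ▸ T.proj_spoke_notMem hn s 0 0⟩

/-- The image in `M` of the barycentre of the facet `(s, i)`. -/
def facetCenter (hn : 3 ≤ n) (s : ι) (i : Fin (n + 1)) : T.Punctured :=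
  ⟨T.proj ⟨s, facetBarycenter hn i⟩, spoke_one hn i ▸ T.proj_spoke_notMem hn s i 1⟩

lemma facetCenter_adj (hn : 3 ≤ n) (s : ι) (i : Fin (n + 1)) :
    T.facetCenter hn (T.adj s i) (T.glue s i i) = T.facetCenter hn s i := by
  refine Subtype.ext (Quot.sound ⟨i, ?_, rfl, fun j => ?_⟩).symm
  · change (if i = i then (0 : ℝ) else (n : ℝ)⁻¹) = 0
    simp
  · change (if T.glue s i j = T.glue s i i then (0 : ℝ) else (n : ℝ)⁻¹)
      = if j = i then 0 else (n : ℝ)⁻¹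
    simp

/-- The half-edge of the dual graph from the barycentre of `s` straight to the barycentre of its
facet `(s, i)`. -/
def halfEdge (hn : 3 ≤ n) (s : ι) (i : Fin (n + 1)) :
    Path (T.center hn s) (T.facetCenter hn s i) where
  toFun t := ⟨T.proj ⟨s, spoke hn i t⟩, T.proj_spoke_notMem hn s i t⟩
  continuous_toFun := Continuous.subtype_mk
    (T.continuous_proj.comp (continuous_sigmaMk.comp (continuous_spoke hn i))) _
  source' := Subtype.ext (by simp [center, spoke_zero])
  target' := Subtype.ext (by simp [facetCenter, spoke_one])

/-- The edge of the dual graph which crosses the facet `(s, i)`. -/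
def dualEdge (hn : 3 ≤ n) (s : ι) (i : Fin (n + 1)) :
    Path (T.center hn s) (T.center hn (T.adj s i)) :=
  (T.halfEdge hn s i).trans
    ((T.halfEdge hn (T.adj s i) (T.glue s i i)).symm.cast (T.facetCenter_adj hn s i).symm rfl)

/-- The path in `M`, contained in the dual graph, which crosses the facets of a facet path. -/
def FacetPath.dualPath {T : SingularTriangulation n ι} (hn : 3 ≤ n) :
    {s t : ι} → T.FacetPath s t → Path (T.center hn s) (T.center hn t)
  | _, _, nil s => Path.refl (T.center hn s)
  | _, _, cons s i γ => (T.dualEdge hn s i).trans (γ.dualPath hn)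

/-- The class in `π₁(M, x₀)` of a facet loop based at `s`, where `x₀` is the barycentre of `s`. -/
def FacetPath.loopClass {T : SingularTriangulation n ι} (hn : 3 ≤ n) {s : ι}
    (γ : T.FacetPath s s) : FundamentalGroup T.Punctured (T.center hn s) :=
  FundamentalGroup.fromPath ⟦γ.dualPath hn⟧

/-- `ρ` is the canonical symmetric representation based at `s`: it is the homomorphism
`π₁(M, x₀) → Sym(s)` with `[γ] ↦ p_γ` for every loop `γ` in the dual graph. (The product in Mathlib's
fundamental group is `[α] * [β] = [β · α]`, path `β` first, matching the composition of maps.) -/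
def IsCanonicalRepresentation (hn : 3 ≤ n) (s : ι)
    (ρ : FundamentalGroup T.Punctured (T.center hn s) →* Equiv.Perm (Fin (n + 1))) : Prop :=
  ∀ γ : T.FacetPath s s, ρ (γ.loopClass hn) = γ.projectivity

end SingularTriangulation

end

/-! Call holonomy the simplex and vertex bijection reached from `s` by crossing only facets opposite
to (transported) vertices of a set `Z`. If `Z` is the zero set of the coordinates of `a`, these are
the facet paths that turn around the open face containing `a`, and two points of simplices have the
same image exactly when such a path carries one to the other (`proj_eq_iff`). Applied to two
vertices of one simplex, this is part (1), up to removing backtracking.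

For part (2), the central notion is `LocallyTrivial`: a path around `a` which brings `a` back to
itself has trivial projectivity. Gluing pairs (point, vertex of its simplex) by the perspectivities
gives a space over the pseudo-manifold which is evenly covered near every locally trivial point. If
this holds away from the vertices, the monodromy on the fibre over the barycentre, which is the
vertex set of the simplex, is the representation.

Local triviality is proved by induction on the codimension of the open face. Codimension 0 is empty
and codimension 1 is the condition that no facet is paired with itself. In codimension 2, evenness
shows that a returning path fixes the two vertices outside the face and is an even permutation; for
`n = 3` this leaves only the identity, and for `n ≥ 4` injectivity on open faces fixes the other
vertices. In higher codimension, a path around the face is shadowed by a loop in the link; the link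
lies over the locus already treated and is simply connected, so the monodromy of the loop is
trivial.

Uniqueness needs none of these hypotheses. Star neighbourhoods contract linearly, so after
subdivision every path is homotopic to a dual path (`isDual`), and dual loops exhaust the
fundamental group. Finally, with fewer than `n + 1` vertices two vertices of the simplex have the
same image, and part (1) gives a loop whose projectivity is not the identity. -/

noncomputable section

/-! ### Relabelling and straight segments in the standard simplex. -/

namespace stdSimplex

variable {X : Type*} [Fintype X]

/-- The point of the standard simplex whose coordinate at `g j` is the coordinate of `a` at `j`. -/
def relabel (g : Equiv.Perm X) (a : stdSimplex ℝ X) : stdSimplex ℝ X :=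
  ⟨fun j => a (g.symm j), fun j => a.2.1 _, by
    rw [Equiv.sum_comp g.symm (fun j => a j)]; exact a.2.2⟩

lemma relabel_apply' (g : Equiv.Perm X) (a : stdSimplex ℝ X) (j : X) :
    relabel g a j = a (g.symm j) := rfl

@[simp] lemma relabel_apply (g : Equiv.Perm X) (a : stdSimplex ℝ X) (j : X) :
    relabel g a (g j) = a j := by
  simp [relabel_apply']

lemma relabel_eq_iff {g : Equiv.Perm X} {a b : stdSimplex ℝ X} :
    relabel g a = b ↔ ∀ j, b (g j) = a j := by
  refine ⟨?_, fun h => ?_⟩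
  · rintro rfl j; simp
  · ext j
    obtain ⟨j, rfl⟩ := g.surjective j
    change relabel g a (g j) = b (g j)
    rw [h, relabel_apply]

@[simp] lemma relabel_one (a : stdSimplex ℝ X) : relabel 1 a = a := rfl

lemma relabel_mul (g h : Equiv.Perm X) (a : stdSimplex ℝ X) :
    relabel (g * h) a = relabel g (relabel h a) := rfl

lemma continuous_coord (j : X) : Continuous fun a : stdSimplex ℝ X => a j :=
  (continuous_apply j).comp continuous_subtype_val

/-- The point at time `r` on the straight segment from `a` to `b`. -/
def mix (a b : stdSimplex ℝ X) (r : unitInterval) : stdSimplex ℝ X :=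
  ⟨fun j => (1 - (r : ℝ)) * a j + r * b j, fun j =>
    add_nonneg (mul_nonneg (sub_nonneg.mpr r.2.2) (a.2.1 j)) (mul_nonneg r.2.1 (b.2.1 j)), by
    rw [Finset.sum_add_distrib, ← Finset.mul_sum, ← Finset.mul_sum, sum_eq_one, sum_eq_one]; ring⟩

@[simp] lemma mix_apply (a b : stdSimplex ℝ X) (r : unitInterval) (j : X) :
    mix a b r j = (1 - (r : ℝ)) * a j + r * b j := rfl

@[simp] lemma mix_zero (a b : stdSimplex ℝ X) : mix a b 0 = a := by
  ext j; change (1 - ((0 : unitInterval) : ℝ)) * a j + ((0 : unitInterval) : ℝ) * b j = a j; simp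

@[simp] lemma mix_one (a b : stdSimplex ℝ X) : mix a b 1 = b := by
  ext j; change (1 - ((1 : unitInterval) : ℝ)) * a j + ((1 : unitInterval) : ℝ) * b j = b j; simp

lemma relabel_mix (g : Equiv.Perm X) (a b : stdSimplex ℝ X) (r : unitInterval) :
    relabel g (mix a b r) = mix (relabel g a) (relabel g b) r := rfl

lemma continuous_mix :
    Continuous fun p : (stdSimplex ℝ X × stdSimplex ℝ X) × unitInterval => mix p.1.1 p.1.2 p.2 := by
  refine Continuous.subtype_mk (continuous_pi fun j => ?_) _
  have h1 := (continuous_coord j).comp (continuous_fst.comp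
    (continuous_fst (X := stdSimplex ℝ X × stdSimplex ℝ X) (Y := unitInterval)))
  have h2 := (continuous_coord j).comp (continuous_snd.comp
    (continuous_fst (X := stdSimplex ℝ X × stdSimplex ℝ X) (Y := unitInterval)))
  have h3 : Continuous fun p : (stdSimplex ℝ X × stdSimplex ℝ X) × unitInterval => (p.2 : ℝ) :=
    continuous_subtype_val.comp continuous_snd
  exact ((continuous_const.sub h3).mul h1).add (h3.mul h2)

/-- The straight segment as a path. -/
def segment (a b : stdSimplex ℝ X) : Path a b where
  toFun := mix a b
  continuous_toFun := continuous_mix.comp (by fun_prop : Continuous fun r => ((a, b), r))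
  source' := mix_zero a b
  target' := mix_one a b

/-- A point whose coordinates are pairwise distinct and positive on `F`, and zero elsewhere. -/
lemma exists_injOn_coord {m : ℕ} (F : Finset (Fin m)) (hF : F.Nonempty) :
    ∃ a : stdSimplex ℝ (Fin m), (∀ i, a i = 0 ↔ i ∉ F) ∧ Set.InjOn a F := by
  classical
  -- The weights `i + 1` are positive and pairwise distinct; dividing by their sum puts the point in
  -- the simplex.
  set S : ℝ := ∑ i ∈ F, ((i : ℝ) + 1) with hS
  have hpos : 0 < S := Finset.sum_pos (fun i _ => by positivity) hF
  obtain ⟨a, e⟩ : ∃ a : stdSimplex ℝ (Fin m),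
      ∀ j, a j = if j ∈ F then ((j : ℝ) + 1) / S else 0 := by
    refine ⟨⟨fun i => if i ∈ F then ((i : ℝ) + 1) / S else 0, fun i => ?_, ?_⟩, fun _ => rfl⟩
    · dsimp only; split_ifs <;> positivity
    · rw [Finset.sum_ite_mem, Finset.univ_inter, ← Finset.sum_div, ← hS, div_self hpos.ne']
  refine ⟨a, fun i => ?_, fun i hi j hj h => ?_⟩
  · rw [e]
    split_ifs with h
    · simpa [h] using ⟨(by positivity : (i : ℝ) + 1 ≠ 0), hpos.ne'⟩
    · simp [h]
  · rw [e, e, if_pos (Finset.mem_coe.mp hi), if_pos (Finset.mem_coe.mp hj), div_left_inj' hpos.ne', add_left_inj] at h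
    exact Fin.ext (by exact_mod_cast h)

end stdSimplex

/-! ### Holonomy around a face, and the identifications made by the quotient map. -/

namespace SingularTriangulation

open stdSimplex Topology

variable {n : ℕ} {ι : Type*} (T : SingularTriangulation n ι)

/-- `T.Holonomy Z s t g`: there is a facet path from `s` to `t` with projectivity `g` which only
crosses facets opposite to the vertices which correspond to elements of `Z` along the path. -/
inductive Holonomy (Z : Set (Fin (n + 1))) (s : ι) : ι → Equiv.Perm (Fin (n + 1)) → Prop
  | refl : Holonomy Z s s 1
  | step {t : ι} {g : Equiv.Perm (Fin (n + 1))} (h : Holonomy Z s t g) {l : Fin (n + 1)}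
      (hl : l ∈ Z) : Holonomy Z s (T.adj t (g l)) (T.glue t (g l) * g)

variable {T}

namespace Holonomy

variable {Z : Set (Fin (n + 1))} {s t u : ι} {g h : Equiv.Perm (Fin (n + 1))}

lemma mono {Z' : Set (Fin (n + 1))} (hZ : Z ⊆ Z') (H : T.Holonomy Z s t g) :
    T.Holonomy Z' s t g := by
  induction H with
  | refl => exact refl
  | step _ hl ih => exact ih.step (hZ hl)

/-- The allowed set of the second path is named by vertices of its own first simplex, hence the
transport by `g`. -/
lemma trans (H : T.Holonomy Z s t g) (K : T.Holonomy (g '' Z) t u h) :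
    T.Holonomy Z s u (h * g) := by
  induction K with
  | refl => simpa using H
  | step _ hl ih =>
    obtain ⟨l, hl, rfl⟩ := hl
    simpa [mul_assoc] using ih.step hl

lemma single {i : Fin (n + 1)} (hi : i ∈ Z) : T.Holonomy Z s (T.adj s i) (T.glue s i) := by
  simpa using (refl (T := T) (Z := Z) (s := s)).step hi

lemma single_symm {i : Fin (n + 1)} (hi : i ∈ Z) :
    T.Holonomy (T.glue s i '' Z) (T.adj s i) s (T.glue s i)⁻¹ := by
  have := single (T := T) (s := T.adj s i) (Set.mem_image_of_mem (T.glue s i) hi)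
  rwa [T.adj_adj, T.glue_glue] at this

lemma symm (H : T.Holonomy Z s t g) : T.Holonomy (g '' Z) t s g⁻¹ := by
  induction H with
  | refl => simpa using refl
  | @step t g _ l hl ih =>
    have h1 := single_symm (T := T) (s := t) (Set.mem_image_of_mem g hl)
    rw [mul_inv_rev]
    have e : ((T.glue t (g l) * g : Equiv.Perm _) '' Z) = T.glue t (g l) '' (g '' Z) := by
      rw [Set.image_image]; rfl
    rw [e]
    refine h1.trans ?_
    have e2 : ((T.glue t (g l))⁻¹ : Equiv.Perm _) '' (T.glue t (g l) '' (g '' Z)) = g '' Z := by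
      rw [Set.image_image]; simp
    rwa [e2]

/-- The transported point keeps its coordinates, so it lies on every facet that is crossed and each
crossing is one of the defining identifications. -/
lemma proj_relabel (H : T.Holonomy Z s t g) (a : stdSimplex ℝ (Fin (n + 1)))
    (ha : ∀ l ∈ Z, a l = 0) : T.proj ⟨t, relabel g a⟩ = T.proj ⟨s, a⟩ := by
  induction H with
  | refl => rfl
  | @step t g _ l hl ih =>
    rw [← ih]
    refine (Quot.sound ⟨g l, ?_, rfl, fun j => ?_⟩).symm
    · change relabel g a (g l) = 0
      simp [ha l hl]
    · change relabel (T.glue t (g l) * g) a (T.glue t (g l) j) = relabel g a j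
      rw [relabel_mul, relabel_apply]

end Holonomy

lemma rel_symm {a b : T.Simplices} (h : T.Rel a b) : T.Rel b a := by
  obtain ⟨s, a⟩ := a
  obtain ⟨t, b⟩ := b
  obtain ⟨i, hi, rfl, hb⟩ := h
  dsimp only at hi hb
  refine ⟨T.glue s i i, by simpa [hb] using hi, (T.adj_adj s i).symm, fun j => ?_⟩
  dsimp only
  rw [T.glue_glue, ← hb]
  simp

/-- Converts equality in the quotient into combinatorics. A chain of identifications never changes
the coordinates up to relabelling, so all its facets correspond to zero coordinates of the initial
point. -/
lemma proj_eq_iff {s t : ι} {a b : stdSimplex ℝ (Fin (n + 1))} :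
    T.proj ⟨s, a⟩ = T.proj ⟨t, b⟩ ↔ ∃ g, T.Holonomy {j | a j = 0} s t g ∧ relabel g a = b := by
  constructor
  · intro h
    have key : ∀ x : T.Simplices, Relation.EqvGen T.Rel ⟨s, a⟩ x →
        ∃ g, T.Holonomy {j | a j = 0} s x.1 g ∧ relabel g a = x.2 := by
      intro x hx
      -- The face pairings are closed under inverses, so the generated equivalence is given by
      -- forward chains alone.
      have hx' : Relation.ReflTransGen T.Rel ⟨s, a⟩ x := by
        clear h
        generalize (⟨s, a⟩ : T.Simplices) = y at hx
        induction hx with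
        | rel _ _ h => exact .single h
        | refl _ => exact .refl
        | symm _ _ _ ih =>
          have : Std.Symm T.Rel := ⟨fun _ _ => rel_symm⟩
          exact Std.Symm.symm _ _ ih
        | trans _ _ _ _ _ ih ih' => exact ih.trans ih'
      clear hx
      induction hx' with
      | refl => exact ⟨1, .refl, rfl⟩
      | @tail y z _ hyz ih =>
        obtain ⟨g, hg, e⟩ := ih
        obtain ⟨y, y'⟩ := y
        obtain ⟨z, z'⟩ := z
        obtain ⟨i, hi, rfl, hz⟩ := hyz
        dsimp only at *
        subst e
        obtain ⟨l, rfl⟩ := g.surjective i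
        rw [relabel_apply] at hi
        exact ⟨_, hg.step hi, by rw [relabel_mul, relabel_eq_iff]; exact hz⟩
    exact key ⟨t, b⟩ (Quot.eqvGen_exact h)
  · rintro ⟨g, hg, rfl⟩
    exact (hg.proj_relabel a fun _ h => h).symm

lemma exists_rep (x : T.Space) : ∃ s a, T.proj ⟨s, a⟩ = x := by
  obtain ⟨⟨s, a⟩, rfl⟩ := Quot.exists_rep x
  exact ⟨s, a, rfl⟩

/-! ### Facet paths -/

namespace FacetPath

lemma projectivity_cast {s s' t : ι} (h : s = s') (γ : T.FacetPath s t) :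
    (h ▸ γ : T.FacetPath s' t).projectivity = γ.projectivity := by
  subst h; rfl

lemma isReduced_cast {s s' t : ι} (h : s = s') (γ : T.FacetPath s t) :
    (h ▸ γ : T.FacetPath s' t).IsReduced ↔ γ.IsReduced := by
  subst h; rfl

/-- Every facet path can be reduced without changing its projectivity. -/
lemma exists_isReduced {s t : ι} (γ : T.FacetPath s t) :
    ∃ δ : T.FacetPath s t, δ.IsReduced ∧ δ.projectivity = γ.projectivity := by
  induction γ with
  | nil s => exact ⟨nil s, trivial, rfl⟩
  | @cons t s i γ ih =>
    obtain ⟨δ, hδ, e⟩ := ih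
    by_cases hs : δ.StartsAt (T.glue s i i)
    · have key : ∀ (r : ι) (δ : T.FacetPath r t) (j : Fin (n + 1)), δ.StartsAt j → δ.IsReduced →
          ∃ δ' : T.FacetPath (T.adj r j) t, δ'.IsReduced ∧
            δ.projectivity = δ'.projectivity * T.glue r j := by
        rintro r (_ | ⟨_, k, δ⟩) j hj hr
        · exact hj.elim
        · obtain rfl : k = j := hj
          exact ⟨δ, hr.2, rfl⟩
      obtain ⟨δ', h1, h2⟩ := key _ δ _ hs hδ
      refine ⟨T.adj_adj s i ▸ δ', (isReduced_cast _ _).mpr h1, ?_⟩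
      rw [projectivity_cast]
      simp only [projectivity]
      rw [← e, h2, T.glue_glue, inv_mul_cancel_right]
    · exact ⟨cons s i δ, ⟨hs, hδ⟩, by simp only [projectivity, e]⟩

/-- Concatenation of facet paths. -/
def append : {s t u : ι} → T.FacetPath s t → T.FacetPath t u → T.FacetPath s u
  | _, _, _, nil _, δ => δ
  | _, _, _, cons s i γ, δ => cons s i (γ.append δ)

lemma projectivity_append {s t u : ι} (γ : T.FacetPath s t) (δ : T.FacetPath t u) :
    (γ.append δ).projectivity = δ.projectivity * γ.projectivity := by
  induction γ with
  | nil s => simp [append, projectivity]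
  | cons s i γ ih => simp [append, projectivity, ih, mul_assoc]

end FacetPath

lemma Holonomy.exists_facetPath {Z : Set (Fin (n + 1))} {s t : ι} {g : Equiv.Perm (Fin (n + 1))}
    (H : T.Holonomy Z s t g) : ∃ γ : T.FacetPath s t, γ.projectivity = g := by
  induction H with
  | refl => exact ⟨.nil s, rfl⟩
  | step _ _ ih =>
    obtain ⟨γ, rfl⟩ := ih
    exact ⟨γ.append (.cons _ _ (.nil _)), by simp [FacetPath.projectivity_append,
      FacetPath.projectivity]⟩

/-- Vertices of a simplex with the same image are exchanged by a reduced facet loop. -/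
lemma exists_isReduced_projectivity_eq (s : ι) (v v' : Fin (n + 1))
    (h : T.proj ⟨s, stdSimplex.vertex v⟩ = T.proj ⟨s, stdSimplex.vertex v'⟩) :
    ∃ γ : T.FacetPath s s, γ.IsReduced ∧ γ.projectivity v = v' := by
  obtain ⟨g, hg, e⟩ := proj_eq_iff.mp h
  obtain ⟨γ, rfl⟩ := hg.exists_facetPath
  obtain ⟨δ, hδ, e'⟩ := γ.exists_isReduced
  refine ⟨δ, hδ, ?_⟩
  rw [relabel_eq_iff] at e
  -- The coordinate of the vertex `v'` at `g v` is that of the vertex `v` at `v`, namely 1; it would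
  -- vanish if `g v ≠ v'`.
  have := e v
  rw [e']
  by_contra hne
  have h0 : ∀ x y : Fin (n + 1), (stdSimplex.vertex x : stdSimplex ℝ (Fin (n + 1))) y
      = (Pi.single x 1 : Fin (n + 1) → ℝ) y := fun _ _ => rfl
  rw [h0, h0, Pi.single_eq_same, Pi.single_eq_of_ne hne] at this
  exact zero_ne_one this

/-! ### Faces mapped onto the same singlex -/

lemma Holonomy.singlex_eq {F : Finset (Fin (n + 1))} {s t : ι} {g : Equiv.Perm (Fin (n + 1))}
    (H : T.Holonomy (F : Set _)ᶜ s t g) :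
    T.singlex t (F.map g.toEmbedding) = T.singlex s F := by
  apply subset_antisymm
  · rintro _ ⟨⟨t', b⟩, ⟨ht, hb⟩, rfl⟩
    dsimp only at ht hb
    subst ht
    have e : relabel g (relabel g⁻¹ b) = b := by rw [← relabel_mul]; simp
    have h0 : ∀ i ∉ F, relabel g⁻¹ b i = 0 := fun i hi => by
      rw [relabel_apply']
      exact hb _ (by simpa [← Equiv.Perm.inv_def] using hi)
    refine ⟨⟨s, relabel g⁻¹ b⟩, ⟨rfl, h0⟩, ?_⟩
    rw [← H.proj_relabel _ (by simpa using h0), e]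
  · rintro _ ⟨⟨t', a⟩, ⟨ht, ha⟩, rfl⟩
    dsimp only at ht ha
    subst ht
    refine ⟨⟨t, relabel g a⟩, ⟨rfl, fun i hi => ?_⟩, H.proj_relabel _ (by simpa using ha)⟩
    obtain ⟨i, rfl⟩ := g.surjective i
    change relabel g a (g i) = 0
    rw [relabel_apply]
    exact ha i (by simpa using hi)

/-- A point in the relative interior of the face has zero set exactly the complement of `F`, so the
holonomy identifying it with a point of the other face goes around the whole face `F`. -/
lemma exists_holonomy_of_singlex_subset {F F' : Finset (Fin (n + 1))} {s t : ι} (hF : F.Nonempty)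
    (h : T.singlex s F ⊆ T.singlex t F') :
    ∃ g, T.Holonomy (F : Set _)ᶜ s t g ∧ F.map g.toEmbedding ⊆ F' := by
  obtain ⟨a, ha, -⟩ := exists_injOn_coord F hF
  obtain ⟨⟨t', b⟩, ⟨ht, hb⟩, e⟩ := h ⟨⟨s, a⟩, ⟨rfl, fun i hi => (ha i).mpr hi⟩, rfl⟩
  dsimp only at ht hb
  subst ht
  obtain ⟨g, hg, rfl⟩ := proj_eq_iff.mp e.symm
  refine ⟨g, ?_, fun j hj => ?_⟩
  · convert hg using 1
    ext i; simp [ha]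
  · obtain ⟨i, hi, rfl⟩ := Finset.mem_map.mp hj
    by_contra h'
    have := hb _ h'
    change relabel g a (g i) = 0 at this
    rw [relabel_apply, ha] at this
    exact this hi

lemma singlex_nonempty_iff {F : Finset (Fin (n + 1))} {s : ι} :
    (T.singlex s F).Nonempty ↔ F.Nonempty := by
  constructor
  · rintro ⟨_, ⟨t, a⟩, ⟨rfl, ha⟩, rfl⟩
    by_contra hF
    rw [Finset.not_nonempty_iff_eq_empty] at hF
    subst hF
    have := sum_eq_one a
    rw [Finset.sum_eq_zero fun i _ => ha i (by simp)] at this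
    exact zero_ne_one this
  · intro hF
    obtain ⟨a, ha, -⟩ := exists_injOn_coord F hF
    exact ⟨_, ⟨s, a⟩, ⟨rfl, fun i hi => (ha i).mpr hi⟩, rfl⟩

/-- Each inclusion provides an embedding of one vertex set into the other, so the cardinalities
agree and the embedding is onto. -/
lemma singlex_eq_iff {F F' : Finset (Fin (n + 1))} {s t : ι} (hF : F.Nonempty) :
    T.singlex t F' = T.singlex s F ↔
      ∃ g, T.Holonomy (F : Set _)ᶜ s t g ∧ F' = F.map g.toEmbedding := by
  constructor
  · intro h
    obtain ⟨g, hg, hsub⟩ := exists_holonomy_of_singlex_subset hF h.symm.subset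
    have hF' : F'.Nonempty := by
      rw [← singlex_nonempty_iff (T := T) (s := t), h]
      exact singlex_nonempty_iff.mpr hF
    obtain ⟨g', -, hsub'⟩ := exists_holonomy_of_singlex_subset hF' h.subset
    refine ⟨g, hg, (Finset.eq_of_subset_of_card_le hsub ?_).symm⟩
    have := Finset.card_le_card hsub'
    simpa using this
  · rintro ⟨g, hg, rfl⟩
    exact hg.singlex_eq

/-! ### Local triviality in codimension zero and one. -/

variable (T) in
/-- The projectivities of facet paths close to the point `a` of the simplex `s` which lead back to
`a` are trivial. -/
def LocallyTrivial (s : ι) (a : stdSimplex ℝ (Fin (n + 1))) : Prop :=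
  ∀ g, T.Holonomy {j | a j = 0} s s g → relabel g a = a → g = 1

lemma Holonomy.eq_one_of_empty {s t : ι} {g : Equiv.Perm (Fin (n + 1))}
    (H : T.Holonomy ∅ s t g) : t = s ∧ g = 1 := by
  induction H with
  | refl => exact ⟨rfl, rfl⟩
  | step _ hl => exact hl.elim

/-- With one permitted facet, a path can only cross it back and forth. -/
lemma Holonomy.of_singleton {i : Fin (n + 1)} {s t : ι} {g : Equiv.Perm (Fin (n + 1))}
    (H : T.Holonomy {i} s t g) : (t = s ∧ g = 1) ∨ (t = T.adj s i ∧ g = T.glue s i) := by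
  induction H with
  | refl => exact .inl ⟨rfl, rfl⟩
  | @step t g _ l hl ih =>
    obtain rfl : l = i := hl
    rcases ih with ⟨rfl, rfl⟩ | ⟨rfl, rfl⟩
    · right; simp
    · left; simp [T.adj_adj, T.glue_glue]

lemma locallyTrivial_of_pos {s : ι} {a : stdSimplex ℝ (Fin (n + 1))} (ha : ∀ j, a j ≠ 0) :
    T.LocallyTrivial s a := by
  intro g hg _
  have : {j | a j = 0} = ∅ := by ext j; simpa using ha j
  rw [this] at hg
  exact hg.eq_one_of_empty.2

/-- The only possible nontrivial return would pair the facet with itself, which `pair_ne` forbids.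
-/
lemma locallyTrivial_of_facet {s : ι} {a : stdSimplex ℝ (Fin (n + 1))} {i : Fin (n + 1)}
    (ha : ∀ j, a j = 0 ↔ j = i) : T.LocallyTrivial s a := by
  intro g hg e
  have : {j | a j = 0} = {i} := by ext j; simpa using ha j
  rw [this] at hg
  rcases hg.of_singleton with ⟨-, h⟩ | ⟨h, h'⟩
  · exact h
  · refine absurd (Prod.ext h.symm ?_) (T.pair_ne s i)
    rw [relabel_eq_iff] at e
    have := e i
    rw [(ha i).mpr rfl, ha, h'] at this
    exact this

/-! ### Codimension two -/

/-- A simplex with two marked vertices `u`, `v` is mapped to the simplex on the other side of the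
facet opposite to `u`, where the facet to be crossed next is the one opposite to the image of `v`.
This is the walk around a face of codimension two. -/
def walk (T : SingularTriangulation n ι) :
    Equiv.Perm (ι × Fin (n + 1) × Fin (n + 1)) where
  toFun x := (T.adj x.1 x.2.1, T.glue x.1 x.2.1 x.2.2, T.glue x.1 x.2.1 x.2.1)
  invFun x := (T.adj x.1 x.2.2, T.glue x.1 x.2.2 x.2.2, T.glue x.1 x.2.2 x.2.1)
  left_inv x := by simp [T.adj_adj, T.glue_glue]
  right_inv x := by simp [T.adj_adj, T.glue_glue]

/-- Exchange the two marked vertices. -/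
def flip : Equiv.Perm (ι × Fin (n + 1) × Fin (n + 1)) where
  toFun x := (x.1, x.2.2, x.2.1)
  invFun x := (x.1, x.2.2, x.2.1)
  left_inv _ := rfl
  right_inv _ := rfl

lemma walk_apply (s : ι) (u v : Fin (n + 1)) :
    T.walk (s, u, v) = (T.adj s u, T.glue s u v, T.glue s u u) := rfl

lemma walk_zpow_add_one_apply (k : ℤ) (x : ι × Fin (n + 1) × Fin (n + 1)) :
    (T.walk ^ (k + 1)) x = T.walk ((T.walk ^ k) x) := by
  rw [add_comm k, zpow_one_add, Equiv.Perm.mul_apply]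

lemma walk_zpow_sub_one_apply (k : ℤ) (x : ι × Fin (n + 1) × Fin (n + 1)) :
    (T.walk ^ (k - 1)) x = T.walk⁻¹ ((T.walk ^ k) x) := by
  rw [sub_eq_neg_add, zpow_add, zpow_neg_one, Equiv.Perm.mul_apply]

lemma flip_apply (s : ι) (u v : Fin (n + 1)) :
    flip (s, u, v) = (s, v, u) := rfl

lemma flip_mul_walk : flip * T.walk = T.walk⁻¹ * flip := by
  ext1 ⟨s, u, v⟩
  rfl

/-- The walk and the exchange satisfy the dihedral relation: exchanging the marked vertices reverses
the direction of walking. -/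
lemma flip_mul_walk_zpow (k : ℤ) : flip * T.walk ^ k = T.walk ^ (-k) * flip := by
  have h : SemiconjBy flip T.walk T.walk⁻¹ := flip_mul_walk
  have := h.zpow_right k
  rw [inv_zpow'] at this
  exact this

lemma walk_ne_flip (x : ι × Fin (n + 1) × Fin (n + 1)) : T.walk x ≠ flip x := by
  obtain ⟨s, u, v⟩ := x
  intro h
  rw [walk_apply, flip_apply, Prod.mk.injEq, Prod.mk.injEq] at h
  exact T.pair_ne s u (Prod.ext h.1 h.2.2)

lemma walk_zpow_ne {x : ι × Fin (n + 1) × Fin (n + 1)} (hx : x.2.1 ≠ x.2.2) (k : ℤ) :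
    ((T.walk ^ k) x).2.1 ≠ ((T.walk ^ k) x).2.2 := by
  induction k with
  | zero => exact hx
  | succ k ih =>
    rw [walk_zpow_add_one_apply]
    generalize (T.walk ^ (k : ℤ)) x = y at ih
    intro h
    exact ih ((T.glue _ _).injective h).symm
  | pred k ih =>
    rw [walk_zpow_sub_one_apply]
    generalize (T.walk ^ (-(k : ℤ))) x = y at ih
    intro h
    exact ih ((T.glue _ _).injective h).symm

/-- The walk around a face of codimension two never comes back in the opposite direction. -/
lemma walk_zpow_ne_flip {x : ι × Fin (n + 1) × Fin (n + 1)} (hx : x.2.1 ≠ x.2.2) (k : ℤ) :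
    (T.walk ^ k) x ≠ flip x := by
  intro h
  rcases Int.even_or_odd' k with ⟨m, rfl | rfl⟩
  -- A reversal would be a reflection of the cycle. For an even exponent it fixes the position
  -- halfway, whose two marked vertices would coincide.
  · have h1 : flip ((T.walk ^ m) x) = (T.walk ^ m) x := by
      rw [← Equiv.Perm.mul_apply, flip_mul_walk_zpow, Equiv.Perm.mul_apply, ← h,
        ← Equiv.Perm.mul_apply, ← zpow_add]
      congr 2; ring
    have := congrArg (fun y => y.2.2) h1
    exact walk_zpow_ne hx m this
  -- For an odd exponent it reflects the middle step, so that a facet would be paired with itself.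
  · have h1 : T.walk ((T.walk ^ m) x) = flip ((T.walk ^ m) x) := by
      rw [← Equiv.Perm.mul_apply flip, flip_mul_walk_zpow, Equiv.Perm.mul_apply, ← h,
        ← Equiv.Perm.mul_apply, ← Equiv.Perm.mul_apply, ← zpow_add, ← zpow_one_add]
      congr 2; ring
    exact walk_ne_flip _ h1

/-- A facet path around a face of codimension two, compared with the walk around it. -/
lemma Holonomy.exists_walk {i j : Fin (n + 1)} {s t : ι} {g : Equiv.Perm (Fin (n + 1))}
    (H : T.Holonomy {i, j} s t g) : ∃ k : ℤ,
      (Even k ∧ (T.walk ^ k) (s, i, j) = (t, g i, g j) ∧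
        T.orientation t * Equiv.Perm.sign g = T.orientation s) ∨
      (Odd k ∧ (T.walk ^ k) (s, i, j) = (t, g j, g i) ∧
        T.orientation t * Equiv.Perm.sign g = -T.orientation s) := by
  induction H with
  | refl => exact ⟨0, .inl ⟨Even.zero, rfl, by simp⟩⟩
  | @step t g _ l hl ih =>
    obtain ⟨k, ih⟩ := ih
    have ho : T.orientation (T.adj t (g l)) * Equiv.Perm.sign (T.glue t (g l) * g)
        = -(T.orientation t * Equiv.Perm.sign g) := by
      rw [Equiv.Perm.sign_mul, ← mul_assoc, T.orientation_adj, neg_mul]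
    have e1 := walk_zpow_add_one_apply (T := T) k (s, i, j)
    have e2 := walk_zpow_sub_one_apply (T := T) k (s, i, j)
    -- Crossing the facet of the first marked vertex is a step forward, that of the second a step
    -- backward. Either way the roles of `i` and `j`, the parity of `k` and the relative orientation
    -- all change.
    rcases ih with ⟨hk, h, h'⟩ | ⟨hk, h, h'⟩ <;> rw [h] at e1 e2 <;> rw [h'] at ho <;>
      rcases hl with rfl | rfl
    · exact ⟨k + 1, .inr ⟨hk.add_one, e1, ho⟩⟩
    · exact ⟨k - 1, .inr ⟨hk.sub_odd odd_one, e2, ho⟩⟩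
    · exact ⟨k - 1, .inl ⟨hk.sub_odd odd_one, e2, by rw [ho, neg_neg]⟩⟩
    · exact ⟨k + 1, .inl ⟨hk.add_one, e1, by rw [ho, neg_neg]⟩⟩

/-- Everything on the walk around a face of codimension two is reached by a facet path. -/
lemma exists_holonomy_walk_zpow (s : ι) (i j : Fin (n + 1)) (k : ℤ) :
    ∃ g, T.Holonomy {i, j} s ((T.walk ^ k) (s, i, j)).1 g ∧
      (((T.walk ^ k) (s, i, j)).2 = (g i, g j) ∨ ((T.walk ^ k) (s, i, j)).2 = (g j, g i)) := by
  induction k with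
  | zero => exact ⟨1, .refl, .inl rfl⟩
  | succ k ih =>
    obtain ⟨g, hg, h⟩ := ih
    rw [walk_zpow_add_one_apply]
    generalize (T.walk ^ (k : ℤ)) (s, i, j) = y at hg h
    obtain ⟨t, y⟩ := y
    dsimp only at hg h
    rcases h with rfl | rfl
    · exact ⟨_, hg.step (l := i) (by simp), .inr rfl⟩
    · exact ⟨_, hg.step (l := j) (by simp), .inl rfl⟩
  | pred k ih =>
    obtain ⟨g, hg, h⟩ := ih
    rw [walk_zpow_sub_one_apply]
    generalize (T.walk ^ (-(k : ℤ))) (s, i, j) = y at hg h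
    obtain ⟨t, y⟩ := y
    dsimp only at hg h
    rcases h with rfl | rfl
    · exact ⟨_, hg.step (l := j) (by simp), .inr rfl⟩
    · exact ⟨_, hg.step (l := i) (by simp), .inl rfl⟩

/-- The degree of a singlex of codimension two is the length of the walk around it. -/
lemma degree_eq_minimalPeriod [Finite ι] (hn : 3 ≤ n) (s : ι) {i j : Fin (n + 1)} (hij : i ≠ j) :
    T.degree s {i, j}ᶜ = Function.minimalPeriod T.walk (s, i, j) := by
  classical
  have := Fintype.ofFinite ι
  have hF : (({i, j}ᶜ : Finset (Fin (n + 1)))).Nonempty := by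
    rw [← Finset.card_pos, Finset.card_compl, Fintype.card_fin, Finset.card_pair hij]; omega
  -- The faces over the singlex are those met by the walk. The image of the orbit forgets the order
  -- of the marked pair, which loses nothing because the walk never returns with that order
  -- reversed.
  have hset : {f : ι × Finset (Fin (n + 1)) | T.singlex f.1 f.2 = T.singlex s {i, j}ᶜ}
      = (fun x : ι × Fin (n + 1) × Fin (n + 1) => (x.1, ({x.2.1, x.2.2}ᶜ : Finset _))) ''
        MulAction.orbit (Subgroup.zpowers T.walk) (s, i, j) := by
    ext ⟨t, F'⟩
    have hmap : ∀ g : Equiv.Perm (Fin (n + 1)),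
        (({i, j}ᶜ : Finset (Fin (n + 1))).map g.toEmbedding) = {g i, g j}ᶜ := by
      intro g
      ext x
      obtain ⟨x, rfl⟩ := g.surjective x
      simp
    have hco : (((({i, j}ᶜ : Finset (Fin (n + 1))) : Set (Fin (n + 1)))ᶜ) : Set _) = {i, j} := by
      rw [Finset.coe_compl, compl_compl]; simp
    simp only [Set.mem_ofPred_eq, singlex_eq_iff hF, hco, hmap]
    constructor
    · rintro ⟨g, hg, rfl⟩
      obtain ⟨k, ⟨-, h, -⟩ | ⟨-, h, -⟩⟩ := hg.exists_walk
      · exact ⟨_, ⟨⟨T.walk ^ k, k, rfl⟩, h⟩, rfl⟩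
      · exact ⟨_, ⟨⟨T.walk ^ k, k, rfl⟩, h⟩, by simp [Finset.pair_comm]⟩
    · rintro ⟨x, ⟨⟨_, k, rfl⟩, rfl⟩, hx⟩
      obtain ⟨g, hg, h⟩ := exists_holonomy_walk_zpow (T := T) s i j k
      change (((T.walk ^ k) (s, i, j)).1, _) = _ at hx
      rw [Prod.mk.injEq] at hx
      obtain ⟨rfl, rfl⟩ := hx
      refine ⟨g, hg, ?_⟩
      change ({((T.walk ^ k) (s, i, j)).2.1, ((T.walk ^ k) (s, i, j)).2.2}ᶜ : Finset _) = _
      rcases h with h | h <;> rw [h]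
      simp [Finset.pair_comm]
  rw [degree, hset, Set.InjOn.ncard_image]
  · rw [Set.ncard_eq_toFinset_card', Set.toFinset_card]
    exact (MulAction.minimalPeriod_eq_card (a := T.walk) (b := (s, i, j))).symm
  · rintro _ ⟨⟨_, k, rfl⟩, rfl⟩ _ ⟨⟨_, l, rfl⟩, rfl⟩ h
    change (T.walk ^ k) (s, i, j) = (T.walk ^ l) (s, i, j)
    change (((T.walk ^ k) (s, i, j)).1, _) = (((T.walk ^ l) (s, i, j)).1, _) at h
    have hk := walk_zpow_ne (T := T) (x := (s, i, j)) hij k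
    have hl := walk_zpow_ne_flip (T := T) (x := (T.walk ^ k) (s, i, j)) hk (l - k)
    rw [← Equiv.Perm.mul_apply, ← zpow_add, sub_add_cancel] at hl
    change (_, ({((T.walk ^ k) (s, i, j)).2.1, ((T.walk ^ k) (s, i, j)).2.2}ᶜ : Finset _))
      = (_, ({((T.walk ^ l) (s, i, j)).2.1, ((T.walk ^ l) (s, i, j)).2.2}ᶜ : Finset _)) at h
    generalize (T.walk ^ k) (s, i, j) = x at *
    generalize (T.walk ^ l) (s, i, j) = y at *
    obtain ⟨x, u, v⟩ := x
    obtain ⟨y, u', v'⟩ := y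
    rw [flip_apply] at hl
    dsimp only at hk
    simp only [Prod.mk.injEq, compl_inj_iff] at h hl ⊢
    obtain ⟨rfl, h⟩ := h
    have h' : ({u, v} : Set (Fin (n + 1))) = {u', v'} := by
      have := congrArg (fun A : Finset (Fin (n + 1)) => (A : Set (Fin (n + 1)))) h
      simpa using this
    rcases (Set.pair_eq_pair_iff).mp h' with h | h
    · exact ⟨rfl, h⟩
    · exact absurd (by rw [h.1, h.2]) hl

/-- Around a singlex of codimension two and even degree, a facet path returning to the same face
fixes the two vertices outside of it, and is an even permutation. -/
lemma Holonomy.fixes_of_isEven [Finite ι] (hn : 3 ≤ n) (hT : T.IsEven) {s : ι} {i j : Fin (n + 1)}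
    (hij : i ≠ j) {g : Equiv.Perm (Fin (n + 1))} (H : T.Holonomy {i, j} s s g)
    (hi : g i ∈ ({i, j} : Set (Fin (n + 1)))) (hj : g j ∈ ({i, j} : Set (Fin (n + 1)))) :
    g i = i ∧ g j = j ∧ Equiv.Perm.sign g = 1 := by
  have hdeg : Even (T.degree s {i, j}ᶜ) := hT s _ (by
    rw [Finset.card_compl, Fintype.card_fin, Finset.card_pair hij]; omega)
  rw [degree_eq_minimalPeriod hn s hij] at hdeg
  have hfix : ∀ k : ℤ, (T.walk ^ k) (s, i, j) = (s, i, j) → Even k := by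
    intro k hk
    have h1 : ((Function.minimalPeriod T.walk (s, i, j) : ℕ) : ℤ) ∣ k :=
      (MulAction.zpow_smul_eq_iff_minimalPeriod_dvd (a := T.walk) (b := (s, i, j)) (n := k)).mp hk
    exact (even_iff_two_dvd.mp ((Int.even_coe_nat _).mpr hdeg)).trans h1 |> even_iff_two_dvd.mpr
  have hflip : ∀ k : ℤ, (T.walk ^ k) (s, i, j) ≠ (s, j, i) :=
    walk_zpow_ne_flip (T := T) (x := (s, i, j)) hij
  have hgij : g i ≠ g j := fun h => hij (g.injective h)
  -- Only an even `k` with both vertices fixed survives: every other case either reverses the walk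
  -- or closes it after an odd number of steps, against the even period.
  obtain ⟨k, ⟨hk, h, ho⟩ | ⟨hk, h, ho⟩⟩ := H.exists_walk
  · have hs : Equiv.Perm.sign g = 1 := by simpa using ho
    rcases hi with hi | hi <;> rcases hj with hj | hj
    · exact absurd (hi.trans hj.symm) hgij
    · exact ⟨hi, hj, hs⟩
    · rw [hi, hj] at h; exact absurd h (hflip k)
    · exact absurd (hi.trans hj.symm) hgij
  · have hk' := Int.not_even_iff_odd.mpr hk
    rcases hi with hi | hi <;> rcases hj with hj | hj
    · exact absurd (hi.trans hj.symm) hgij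
    · rw [hi, hj] at h; exact absurd h (hflip k)
    · rw [hi, hj] at h; exact absurd (hfix k h) hk'
    · exact absurd (hi.trans hj.symm) hgij

/-- If the quotient map is injective on the relative interiors of faces, a facet path around a face
which returns to that face fixes it pointwise. -/
lemma Holonomy.fixes_of_injectiveOnInteriors (hT : T.InjectiveOnInteriors) {s : ι}
    {a : stdSimplex ℝ (Fin (n + 1))} {g : Equiv.Perm (Fin (n + 1))}
    (H : T.Holonomy {j | a j = 0} s s g) (hg : relabel g a = a) {j : Fin (n + 1)} (hj : a j ≠ 0) :
    g j = j := by
  classical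
  rw [relabel_eq_iff] at hg
  -- The point `b` lies in the same open face as `a` but has distinct nonzero coordinates. The
  -- holonomy identifies `b` with its relabelling in that open face, so they are equal, and
  -- distinctness fixes the vertices.
  obtain ⟨b, hb, hinj⟩ := exists_injOn_coord (Finset.univ.filter fun j => a j ≠ 0) ⟨j, by simpa⟩
  have hb' : ∀ i, b i = 0 ↔ a i = 0 := fun i => by simp [hb]
  have h1 := H.proj_relabel b fun l hl => (hb' l).mpr hl
  have h2 := hT s (relabel g b) b (fun i => by
    obtain ⟨i, rfl⟩ := g.surjective i
    rw [relabel_apply, hb', hb', hg]) h1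
  rw [relabel_eq_iff] at h2
  exact hinj (by simpa [hg] using hj) (by simpa using hj) (h2 j)

/-- Evenness controls the two vertices outside the face. Those of the face are controlled by
injectivity if `n ≥ 4`, and by the sign if `n = 3`. -/
lemma locallyTrivial_of_codim_two [Finite ι] (hn : 3 ≤ n) (hT : T.IsEven)
    (hinj : 4 ≤ n → T.InjectiveOnInteriors) {s : ι} {a : stdSimplex ℝ (Fin (n + 1))}
    {i j : Fin (n + 1)} (hij : i ≠ j) (ha : ∀ l, a l = 0 ↔ l = i ∨ l = j) :
    T.LocallyTrivial s a := by
  intro g H hg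
  have hZ : {l | a l = 0} = {i, j} := by ext l; simpa using ha l
  have hg' := relabel_eq_iff.mp hg
  have hmem : ∀ l, a l = 0 → g l ∈ ({i, j} : Set (Fin (n + 1))) := fun l hl => by
    rw [← hZ, Set.mem_ofPred_eq, hg', hl]
  obtain ⟨hi, hj, hs⟩ := (hZ ▸ H).fixes_of_isEven hn hT hij
    (hmem i ((ha i).mpr (.inl rfl))) (hmem j ((ha j).mpr (.inr rfl)))
  rcases Nat.lt_or_ge 3 n with h4 | h3
  · ext l
    by_cases hl : a l = 0
    · rcases (ha l).mp hl with rfl | rfl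
      · rw [hi]; rfl
      · rw [hj]; rfl
    · rw [H.fixes_of_injectiveOnInteriors (hinj h4) hg hl]; rfl
  -- Here `n = 3`: a nontrivial `g` fixing `i` and `j` would be the transposition of the other two
  -- vertices, which is odd.
  · by_contra hne
    have h2 := Equiv.Perm.two_le_card_support_of_ne_one hne
    have hsub : g.support ⊆ {i, j}ᶜ := by
      intro l hl
      rw [Equiv.Perm.mem_support] at hl
      simp only [Finset.mem_compl, Finset.mem_insert, Finset.mem_singleton, not_or]
      exact ⟨fun e => hl (e ▸ hi), fun e => hl (e ▸ hj)⟩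
    have hle := Finset.card_le_card hsub
    rw [Finset.card_compl, Fintype.card_fin, Finset.card_pair hij] at hle
    have hsw := Equiv.Perm.card_support_eq_two.mp (by omega : g.support.card = 2)
    rw [hsw.sign_eq] at hs
    exact absurd hs (by decide)

/-! ### Star neighbourhoods -/

/-- The nearby points of the simplices around the point `a` of the simplex `s`: the point `b` is
within `ε` of the point to which `a` is moved by a facet path near `a` with projectivity `g`. -/
structure Near (s : ι) (a : stdSimplex ℝ (Fin (n + 1))) (ε : ℝ) (b : T.Simplices)
    (g : Equiv.Perm (Fin (n + 1))) : Prop where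
  holonomy : T.Holonomy {j | a j = 0} s b.1 g
  abs_lt : ∀ j, |b.2 (g j) - a j| < ε

/-- Distinct elements of `0`, `1` and the coordinates of `a` are at least `2 * ε` apart. -/
def Separates (a : stdSimplex ℝ (Fin (n + 1))) (ε : ℝ) : Prop :=
  0 < ε ∧ ∀ u ∈ ({0, 1} ∪ Set.range a : Set ℝ), ∀ v ∈ ({0, 1} ∪ Set.range a : Set ℝ),
    u ≠ v → 2 * ε ≤ |u - v|

lemma exists_separates (a : stdSimplex ℝ (Fin (n + 1))) : ∃ ε, Separates a ε := by
  have hfin : ({0, 1} ∪ Set.range a : Set ℝ).Finite :=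
    (Set.toFinite {0, 1}).union (Set.finite_range _)
  have h1 : ∀ᶠ ε : ℝ in 𝓝[>] 0, ∀ u ∈ ({0, 1} ∪ Set.range a : Set ℝ),
      ∀ v ∈ ({0, 1} ∪ Set.range a : Set ℝ), u ≠ v → 2 * ε ≤ |u - v| := by
    rw [Filter.eventually_all_finite hfin]
    intro u _
    rw [Filter.eventually_all_finite hfin]
    intro v _
    by_cases huv : u = v
    · simp [huv]
    · have hpos : 0 < |u - v| / 2 := half_pos (abs_pos.mpr (sub_ne_zero.mpr huv))
      filter_upwards [Ioo_mem_nhdsGT hpos] with ε hε _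
      linarith [hε.2]
  have h2 : ∀ᶠ ε : ℝ in 𝓝[>] 0, 0 < ε := eventually_mem_nhdsWithin
  exact (h2.and h1).exists

lemma Separates.eq {a : stdSimplex ℝ (Fin (n + 1))} {ε : ℝ} (hε : Separates a ε) {u v x : ℝ}
    (hu : u ∈ ({0, 1} ∪ Set.range a : Set ℝ)) (hv : v ∈ ({0, 1} ∪ Set.range a : Set ℝ))
    (h : |x - u| < ε) (h' : |x - v| < ε) : u = v := by
  by_contra hne
  have h1 := hε.2 u hu v hv hne
  have h2 := abs_sub_le u x v
  rw [abs_sub_comm u x] at h2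
  linarith

lemma near_self (s : ι) {a : stdSimplex ℝ (Fin (n + 1))} {ε : ℝ} (hε : 0 < ε) :
    T.Near s a ε ⟨s, a⟩ 1 :=
  ⟨.refl, by simpa using hε⟩

namespace Near

variable {s : ι} {a : stdSimplex ℝ (Fin (n + 1))} {ε : ℝ} {b b' : T.Simplices}
  {g g' h : Equiv.Perm (Fin (n + 1))}

/-- The star meets only facets through its centre. This is why 0 is among the separated values; 1 is
there so that the star of a non-vertex avoids the vertices. -/
lemma eq_zero (hε : Separates a ε) (H : T.Near s a ε b g) {j : Fin (n + 1)}
    (hj : b.2 (g j) = 0) : a j = 0 :=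
  hε.eq (x := 0) (by simp) (by simp) (by simpa [hj] using H.abs_lt j) (by simpa using hε.1)

lemma lt_one (hε : Separates a ε) (ha : ∀ j, a j < 1) (H : T.Near s a ε b g) (j : Fin (n + 1)) :
    b.2 j < 1 := by
  refine lt_of_le_of_ne (stdSimplex.le_one _ _) fun hj => ?_
  obtain ⟨j, rfl⟩ := g.surjective j
  exact (ha j).ne (hε.eq (x := 1) (by simp) (by simp) (by simpa [hj] using H.abs_lt j)
    (by simpa using hε.1))

/-- Makes the nearby points a saturated set: every further identification of `b` is again a crossing
around `a`. -/
lemma move (hε : Separates a ε) (H : T.Near s a ε b g)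
    (K : T.Holonomy {j | b.2 j = 0} b.1 b'.1 h) (e : relabel h b.2 = b'.2) :
    T.Near s a ε b' (h * g) := by
  refine ⟨H.holonomy.trans (K.mono ?_), fun j => ?_⟩
  · intro l hl
    obtain ⟨l, rfl⟩ := g.surjective l
    exact ⟨l, H.eq_zero hε hl, rfl⟩
  · rw [Equiv.Perm.mul_apply, relabel_eq_iff.mp e]
    exact H.abs_lt j

/-- The copy of the centre close to `b` is unique even without local triviality, since each
coordinate of `b` is within `ε` of at most one value taken by `a`. -/
lemma relabel_eq_relabel (hε : Separates a ε) (H : T.Near s a ε b g) (H' : T.Near s a ε b g') :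
    relabel g a = relabel g' a := by
  ext j
  change a (g.symm j) = a (g'.symm j)
  have h1 := H.abs_lt (g.symm j)
  have h2 := H'.abs_lt (g'.symm j)
  rw [Equiv.apply_symm_apply] at h1 h2
  exact hε.eq (by simp) (by simp) h1 h2

/-- Going out by `g'` and back by `g` returns `a` to itself. Local triviality thus makes the
labelling of the star by the vertices at its centre unambiguous. -/
lemma eq (hε : Separates a ε) (ha : T.LocallyTrivial s a) (H : T.Near s a ε b g)
    (H' : T.Near s a ε b g') : g = g' := by
  have e := H.relabel_eq_relabel hε H'
  have hZ : g '' {j | a j = 0} = g' '' {j | a j = 0} := by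
    ext j
    have := congrArg (fun c : stdSimplex ℝ (Fin (n + 1)) => c j = 0) e
    simpa [relabel_apply', Equiv.image_eq_preimage_symm] using this
  have h1 := (H'.holonomy.trans (hZ ▸ H.holonomy.symm))
  have := ha _ h1 (by rw [relabel_mul, ← e, ← relabel_mul]; simp)
  rw [inv_mul_eq_one] at this
  exact this

end Near

lemma isOpen_near (s : ι) (a : stdSimplex ℝ (Fin (n + 1))) (ε : ℝ)
    (g : Equiv.Perm (Fin (n + 1))) : IsOpen {b : T.Simplices | T.Near s a ε b g} := by
  rw [isOpen_sigma_iff]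
  intro t
  by_cases ht : T.Holonomy {j | a j = 0} s t g
  · have : Sigma.mk t ⁻¹' {b : T.Simplices | T.Near s a ε b g}
        = ⋂ j, {b : stdSimplex ℝ (Fin (n + 1)) | |b (g j) - a j| < ε} := by
      ext b
      simp only [Set.mem_preimage, Set.mem_ofPred_eq, Set.mem_iInter]
      exact ⟨fun h => h.abs_lt, fun h => ⟨ht, h⟩⟩
    rw [this]
    exact isOpen_iInter_of_finite fun j =>
      isOpen_lt ((continuous_coord (g j)).sub continuous_const).abs continuous_const
  · have : Sigma.mk t ⁻¹' {b : T.Simplices | T.Near s a ε b g} = ∅ := by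
      ext b
      simp only [Set.mem_preimage, Set.mem_ofPred_eq, Set.mem_empty_iff_false, iff_false]
      exact fun h => ht h.holonomy
    rw [this]
    exact isOpen_empty

/-- The star neighbourhood of radius `ε` of the image of the point `a` of the simplex `s`. -/
def star (T : SingularTriangulation n ι) (s : ι) (a : stdSimplex ℝ (Fin (n + 1))) (ε : ℝ) :
    Set T.Space :=
  T.proj '' {b | ∃ g, T.Near s a ε b g}

lemma proj_mem_star_iff {s : ι} {a : stdSimplex ℝ (Fin (n + 1))} {ε : ℝ} (hε : Separates a ε)
    {b : T.Simplices} : T.proj b ∈ T.star s a ε ↔ ∃ g, T.Near s a ε b g := by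
  constructor
  · rintro ⟨b', ⟨g, hg⟩, e⟩
    obtain ⟨h, hh, e'⟩ := proj_eq_iff.mp e
    exact ⟨_, hg.move hε hh e'⟩
  · exact fun h => ⟨b, h, rfl⟩

lemma isOpen_star {s : ι} {a : stdSimplex ℝ (Fin (n + 1))} {ε : ℝ} (hε : Separates a ε) :
    IsOpen (T.star s a ε) := by
  change IsOpen (T.proj ⁻¹' T.star s a ε)
  have : T.proj ⁻¹' T.star s a ε = ⋃ g, {b : T.Simplices | T.Near s a ε b g} := by
    ext b
    rw [Set.mem_preimage, proj_mem_star_iff hε, Set.mem_iUnion]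
    rfl
  rw [this]
  exact isOpen_iUnion fun g => isOpen_near s a ε g

lemma proj_mem_star_self {s : ι} {a : stdSimplex ℝ (Fin (n + 1))} {ε : ℝ} (hε : Separates a ε) :
    T.proj ⟨s, a⟩ ∈ T.star s a ε :=
  ⟨_, ⟨1, near_self s hε.1⟩, rfl⟩

/-! ### The covering by the vertices of simplices -/

/-- The face pairings, lifted to points together with a vertex of the simplex containing them. -/
def CoverRel (T : SingularTriangulation n ι) (x y : T.Simplices × Fin (n + 1)) : Prop :=
  ∃ i, x.1.2 i = 0 ∧ y.1.1 = T.adj x.1.1 i ∧ (∀ j, y.1.2 (T.glue x.1.1 i j) = x.1.2 j) ∧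
    y.2 = T.glue x.1.1 i x.2

/-- The space of the points of simplices together with a vertex of the simplex, glued by means of the
perspectivities. It is a covering over the points where the triangulation is locally trivial. -/
def VertexCover (T : SingularTriangulation n ι) : Type _ := Quot T.CoverRel

instance : TopologicalSpace T.VertexCover := inferInstanceAs (TopologicalSpace (Quot T.CoverRel))

/-- The quotient map to the covering. -/
def coverMk (T : SingularTriangulation n ι) (a : T.Simplices) (v : Fin (n + 1)) : T.VertexCover :=
  Quot.mk T.CoverRel (a, v)

/-- The covering projection. -/
def coverProj (T : SingularTriangulation n ι) : T.VertexCover → T.Space :=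
  Quot.lift (fun x => T.proj x.1) (by
    rintro x y ⟨i, h1, h2, h3, -⟩
    exact Quot.sound ⟨i, h1, h2, h3⟩)

@[simp] lemma coverProj_coverMk (a : T.Simplices) (v : Fin (n + 1)) :
    T.coverProj (T.coverMk a v) = T.proj a := rfl

lemma continuous_coverMk (v : Fin (n + 1)) : Continuous fun a => T.coverMk a v :=
  continuous_quot_mk.comp (by fun_prop : Continuous fun a : T.Simplices => (a, v))

lemma Holonomy.coverMk_relabel {Z : Set (Fin (n + 1))} {s t : ι} {g : Equiv.Perm (Fin (n + 1))}
    (H : T.Holonomy Z s t g) (a : stdSimplex ℝ (Fin (n + 1))) (ha : ∀ l ∈ Z, a l = 0)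
    (v : Fin (n + 1)) : T.coverMk ⟨t, relabel g a⟩ (g v) = T.coverMk ⟨s, a⟩ v := by
  induction H with
  | refl => rfl
  | @step t g _ l hl ih =>
    rw [← ih]
    refine (Quot.sound ⟨g l, ?_, rfl, fun j => ?_, rfl⟩).symm
    · change relabel g a (g l) = 0
      simp [ha l hl]
    · change relabel (T.glue t (g l) * g) a (T.glue t (g l) j) = relabel g a j
      rw [relabel_mul, relabel_apply]

/-- The sheet over a star neighbourhood, containing the vertex `l` at the centre. -/
def sheet (T : SingularTriangulation n ι) (s : ι) (a : stdSimplex ℝ (Fin (n + 1))) (ε : ℝ)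
    (l : Fin (n + 1)) : Set T.VertexCover :=
  {e | ∃ b g, T.Near s a ε b g ∧ T.coverMk b (g l) = e}

lemma coverMk_mem_sheet_iff {s : ι} {a : stdSimplex ℝ (Fin (n + 1))} {ε : ℝ}
    (hε : Separates a ε) {l : Fin (n + 1)} {b : T.Simplices} {v : Fin (n + 1)} :
    T.coverMk b v ∈ T.sheet s a ε l ↔ ∃ g, T.Near s a ε b g ∧ v = g l := by
  constructor
  · rintro ⟨b', g, hg, e⟩
    have step : ∀ x y : T.Simplices × Fin (n + 1), T.CoverRel x y →
        (∃ g, T.Near s a ε x.1 g ∧ x.2 = g l) → ∃ g, T.Near s a ε y.1 g ∧ y.2 = g l := by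
      rintro ⟨⟨t, x⟩, v⟩ ⟨⟨u, y⟩, w⟩ ⟨i, h1, rfl, h3, rfl⟩ ⟨g, hg, rfl⟩
      dsimp only at *
      exact ⟨_, hg.move hε (Holonomy.single (i := i) h1) (relabel_eq_iff.mpr h3), rfl⟩
    have symm : ∀ x y : T.Simplices × Fin (n + 1), T.CoverRel x y → T.CoverRel y x := by
      rintro ⟨⟨t, x⟩, v⟩ ⟨⟨u, y⟩, w⟩ ⟨i, h1, rfl, h3, rfl⟩
      dsimp only at *
      obtain ⟨j, h4, h5, h6⟩ := rel_symm (T := T) (a := ⟨t, x⟩) (b := ⟨_, y⟩) ⟨i, h1, rfl, h3⟩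
      refine ⟨T.glue t i i, by simpa [h3] using h1, (T.adj_adj t i).symm, fun j => ?_, ?_⟩
      · dsimp only
        rw [T.glue_glue, ← h3]
        simp
      · dsimp only
        rw [T.glue_glue]
        simp
    have key : ∀ x y : T.Simplices × Fin (n + 1), T.CoverRel x y →
        (∃ g, T.Near s a ε x.1 g ∧ x.2 = g l) = ∃ g, T.Near s a ε y.1 g ∧ y.2 = g l :=
      fun x y h => propext ⟨step x y h, step y x (symm x y h)⟩
    -- Membership is invariant under the gluing relation, so it descends to the quotient as a
    -- predicate and can be read off any representative.
    have h2 : Quot.lift _ key (T.coverMk b' (g l)) := ⟨g, hg, rfl⟩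
    rw [e] at h2
    exact h2
  · rintro ⟨g, hg, rfl⟩
    exact ⟨b, g, hg, rfl⟩

/-- Distinct vertices at a locally trivial point lie in different sheets of a small star. -/
lemma LocallyTrivial.coverMk_injective {s : ι} {a : stdSimplex ℝ (Fin (n + 1))}
    (ha : T.LocallyTrivial s a) : Function.Injective (T.coverMk ⟨s, a⟩) := by
  obtain ⟨ε, hε⟩ := exists_separates a
  intro v w h
  have h1 : T.coverMk ⟨s, a⟩ v ∈ T.sheet s a ε v := ⟨_, 1, near_self s hε.1, rfl⟩
  rw [h, coverMk_mem_sheet_iff hε] at h1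
  obtain ⟨g, hg, rfl⟩ := h1
  rw [← (near_self s hε.1).eq hε ha hg]
  rfl

/-- A point is evenly covered if the triangulation is locally trivial there. -/
lemma LocallyTrivial.exists_trivialization {s : ι} {a : stdSimplex ℝ (Fin (n + 1))}
    (ha : T.LocallyTrivial s a) :
    ∃ e : Bundle.Trivialization (Fin (n + 1)) T.coverProj, T.proj ⟨s, a⟩ ∈ e.baseSet := by
  obtain ⟨ε, hε⟩ := exists_separates a
  have hne : Nonempty (T.Space → T.VertexCover) := ⟨fun _ => T.coverMk ⟨s, a⟩ 0⟩
  -- Local triviality enters twice: each sheet maps injectively to the star, and different sheets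
  -- are disjoint.
  refine ⟨IsOpen.trivializationDiscrete (f := T.coverProj) (T.sheet s a ε) (T.star s a ε)
    (isOpen_star hε) (fun l W hW => ?_) (fun l => ?_) (fun l => ?_) ?_ ?_,
    proj_mem_star_self hε⟩
  · have hpre : ∀ v, (fun b => T.coverMk b v) ⁻¹' (T.coverProj ⁻¹' W ∩ T.sheet s a ε l)
        = T.proj ⁻¹' W ∩ ⋃ (g : Equiv.Perm (Fin (n + 1))) (_ : v = g l),
          {b | T.Near s a ε b g} := by
      intro v
      ext b
      simp only [Set.mem_preimage, Set.mem_inter_iff, coverProj_coverMk, coverMk_mem_sheet_iff hε,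
        Set.mem_iUnion, Set.mem_ofPred_eq]
      refine and_congr_right fun _ => exists_congr fun g => ?_
      rw [and_comm, exists_prop]
    constructor
    · intro hWo
      suffices h : IsOpen {p : T.Simplices × Fin (n + 1) |
          T.coverMk p.1 p.2 ∈ T.coverProj ⁻¹' W ∩ T.sheet s a ε l} from h
      have hU : ∀ A : Set (T.Simplices × Fin (n + 1)),
          A = ⋃ v, ((fun b => (b, v)) ⁻¹' A) ×ˢ {v} := fun A => by ext ⟨b, v⟩; simp
      rw [hU {p | _}]
      refine isOpen_iUnion fun v => IsOpen.prod ?_ (isOpen_discrete _)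
      have := (hWo.preimage T.continuous_proj).inter
        (isOpen_iUnion fun g => isOpen_iUnion fun _ : v = g l => isOpen_near s a ε g)
      rw [← hpre v] at this
      exact this
    · intro ho
      change IsOpen (T.proj ⁻¹' W)
      have : T.proj ⁻¹' W
          = ⋃ v, (fun b => T.coverMk b v) ⁻¹' (T.coverProj ⁻¹' W ∩ T.sheet s a ε l) := by
        ext b
        simp only [hpre, Set.mem_iUnion, Set.mem_inter_iff]
        refine ⟨fun hb => ?_, fun ⟨_, hb, _⟩ => hb⟩
        obtain ⟨g, hg⟩ := (proj_mem_star_iff hε).mp (hW hb)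
        exact ⟨g l, hb, g, rfl, hg⟩
      rw [this]
      exact isOpen_iUnion fun v => ho.preimage (continuous_coverMk v)
  · rintro _ ⟨b, g, hg, rfl⟩ _ ⟨b', g', hg', rfl⟩ h
    rw [coverProj_coverMk, coverProj_coverMk] at h
    obtain ⟨h, hh, e⟩ := proj_eq_iff.mp h
    have := (hg.move (b' := b') hε hh e).eq hε ha hg'
    rw [← this, ← hh.coverMk_relabel b.2 (fun _ h => h), e]
    rfl
  · rintro _ ⟨b, ⟨g, hg⟩, rfl⟩
    exact ⟨T.coverMk b (g l), ⟨b, g, hg, rfl⟩, rfl⟩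
  · intro l l' hll
    rw [Function.onFun, Set.disjoint_left]
    rintro _ ⟨b, g, hg, rfl⟩ h
    obtain ⟨g', hg', e⟩ := (coverMk_mem_sheet_iff hε).mp h
    rw [hg.eq hε ha hg'] at e
    exact hll (g'.injective e)
  · intro e he
    obtain ⟨⟨b, v⟩, rfl⟩ := Quot.exists_rep e
    obtain ⟨g, hg⟩ := (proj_mem_star_iff hε).mp he
    exact Set.mem_iUnion.mpr ⟨g.symm v, b, g, hg, by rw [Equiv.apply_symm_apply]; rfl⟩

variable (T) in
/-- The set of points where the triangulation is locally trivial. -/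
def trivialLocus : Set T.Space :=
  {x | ∃ s a, T.LocallyTrivial s a ∧ T.proj ⟨s, a⟩ = x}

lemma isCoveringMapOn_trivialLocus : IsCoveringMapOn T.coverProj T.trivialLocus := by
  have h : ∀ x : T.trivialLocus, ∃ e : Bundle.Trivialization (Fin (n + 1)) T.coverProj,
      x.1 ∈ e.baseSet := by
    rintro ⟨_, s, a, ha, rfl⟩
    exact ha.exists_trivialization
  choose e he using h
  exact IsCoveringMapOn.mk _ _ (fun _ => Fin (n + 1)) e he

lemma isCoveringMap_restrictPreimage {S : Set T.Space} (hS : S ⊆ T.trivialLocus) :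
    IsCoveringMap (S.restrictPreimage T.coverProj) :=
  (isCoveringMapOn_trivialLocus.mono hS).isCoveringMap_restrictPreimage

/-! ### Lifts of paths -/

/-- The path `γ` from the image of `a` to the image of `b` lifts to the covering in such a way that
the vertices of the simplex containing `a` are moved by `g`. -/
structure Lifts {S : Set T.Space} {x y : S} (γ : Path x y) (a b : T.Simplices)
    (g : Equiv.Perm (Fin (n + 1))) : Prop where
  exists_path : ∀ v, ∃ Γ : Path (T.coverMk a v) (T.coverMk b (g v)),
    ∀ r, T.coverProj (Γ r) = γ r

namespace Lifts

variable {S : Set T.Space} {x y z : S} {γ : Path x y} {a b c : T.Simplices}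
  {g h : Equiv.Perm (Fin (n + 1))}

lemma trans {γ' : Path y z} (H : T.Lifts γ a b g) (H' : T.Lifts γ' b c h) :
    T.Lifts (γ.trans γ') a c (h * g) := by
  refine ⟨fun v => ?_⟩
  obtain ⟨Γ, hΓ⟩ := H.exists_path v
  obtain ⟨Γ', hΓ'⟩ := H'.exists_path (g v)
  refine ⟨(Γ.trans Γ').cast rfl rfl, fun r => ?_⟩
  change T.coverProj ((Γ.trans Γ') r) = _
  rw [Path.trans_apply, Path.trans_apply]
  split_ifs
  · exact hΓ _
  · exact hΓ' _

lemma symm (H : T.Lifts γ a b g) : T.Lifts γ.symm b a g⁻¹ := by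
  refine ⟨fun v => ?_⟩
  obtain ⟨Γ, hΓ⟩ := H.exists_path (g⁻¹ v)
  exact ⟨Γ.symm.cast (by simp) rfl, fun r => hΓ _⟩

lemma cast {x' y' : S} (hx : x' = x) (hy : y' = y) (H : T.Lifts γ a b g) :
    T.Lifts (γ.cast hx hy) a b g :=
  ⟨H.exists_path⟩

lemma refl {a : T.Simplices} (h : T.proj a = x) : T.Lifts (Path.refl x) a a 1 :=
  ⟨fun _ => ⟨Path.refl _, fun _ => h⟩⟩

/-- A path in a simplex lifts with constant vertex. -/
lemma of_path {s : ι} {a b : stdSimplex ℝ (Fin (n + 1))} (δ : Path a b)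
    (h : ∀ r, (γ r : T.Space) = T.proj ⟨s, δ r⟩) : T.Lifts γ ⟨s, a⟩ ⟨s, b⟩ 1 := by
  refine ⟨fun v => ⟨⟨⟨fun r => T.coverMk ⟨s, δ r⟩ v, ?_⟩, ?_, ?_⟩, fun r => (h r).symm⟩⟩
  · exact (continuous_coverMk v).comp (continuous_sigmaMk.comp δ.continuous)
  · simp
  · simp

/-- Change the representative of the end point. -/
lemma move {s t : ι} {b : stdSimplex ℝ (Fin (n + 1))} (H : T.Lifts γ a ⟨s, b⟩ g)
    (K : T.Holonomy {j | b j = 0} s t h) : T.Lifts γ a ⟨t, relabel h b⟩ (h * g) := by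
  refine ⟨fun v => ?_⟩
  obtain ⟨Γ, hΓ⟩ := H.exists_path v
  exact ⟨Γ.cast rfl (K.coverMk_relabel b (fun _ h => h) (g v)), hΓ⟩

/-- The monodromy along a path with known lifts. -/
lemma monodromy_eq (H : T.Lifts γ a b g) (hS : S ⊆ T.trivialLocus) (v : Fin (n + 1))
    {hxS : T.coverMk a v ∈ T.coverProj ⁻¹' S} {hyS : T.coverMk b (g v) ∈ T.coverProj ⁻¹' S}
    (hx : S.restrictPreimage T.coverProj ⟨T.coverMk a v, hxS⟩ = x)
    (hy : S.restrictPreimage T.coverProj ⟨T.coverMk b (g v), hyS⟩ = y) :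
    (isCoveringMap_restrictPreimage hS).monodromy (.mk γ) ⟨⟨T.coverMk a v, hxS⟩, hx⟩
      = ⟨⟨T.coverMk b (g v), hyS⟩, hy⟩ := by
  obtain ⟨Γ, hΓ⟩ := H.exists_path v
  have hmem : ∀ r, Γ r ∈ T.coverProj ⁻¹' S := fun r => by
    rw [Set.mem_preimage, hΓ]; exact (γ r).2
  let Γ' : Path (⟨T.coverMk a v, hxS⟩ : T.coverProj ⁻¹' S) ⟨T.coverMk b (g v), hyS⟩ :=
    { toFun r := ⟨Γ r, hmem r⟩
      continuous_toFun := Γ.continuous.subtype_mk hmem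
      source' := Subtype.ext Γ.source
      target' := Subtype.ext Γ.target }
  refine (isCoveringMap_restrictPreimage hS).monodromy_eq_of_map_eq (.mk Γ') ?_
  refine congrArg Path.Homotopic.Quotient.mk ?_
  ext r
  exact hΓ r

/-- Over a simply connected set, loops have trivial lifts. -/
lemma eq_one_of_simplyConnected [SimplyConnectedSpace S] (hS : S ⊆ T.trivialLocus)
    {s : ι} {a : stdSimplex ℝ (Fin (n + 1))} (ha : T.LocallyTrivial s a)
    (hx : T.proj ⟨s, a⟩ = x) (hy : T.proj ⟨s, a⟩ = y)
    (H : T.Lifts γ ⟨s, a⟩ ⟨s, a⟩ g) : g = 1 := by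
  obtain rfl : x = y := Subtype.ext (hx.symm.trans hy)
  have hmem : ∀ v, T.coverMk ⟨s, a⟩ v ∈ T.coverProj ⁻¹' S := fun v => by
    rw [Set.mem_preimage, coverProj_coverMk, hx]; exact x.2
  have hx' : ∀ v, S.restrictPreimage T.coverProj ⟨T.coverMk ⟨s, a⟩ v, hmem v⟩ = x :=
    fun v => Subtype.ext hx
  ext1 v
  have h1 := H.monodromy_eq hS v (hx' v) (hx' (g v))
  -- Simple connectedness makes `γ` homotopic to the constant path, so both lifts starting at `v`
  -- have the same end point.
  have h2 : Path.Homotopic.Quotient.mk γ = Path.Homotopic.Quotient.mk (Path.refl x) :=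
    Subsingleton.elim _ _
  have h3 := (refl (S := S) (x := x) hx).monodromy_eq hS v (hx' v) (hx' v)
  rw [h2, h3] at h1
  have := congrArg (fun e => e.1.1) h1
  exact (ha.coverMk_injective this).symm

end Lifts

/-! ### Links -/

lemma exists_lifts_segment {S : Set T.Space} {s : ι} {a b : stdSimplex ℝ (Fin (n + 1))}
    (h : ∀ r, T.proj ⟨s, mix a b r⟩ ∈ S) {x y : S} (hx : x.1 = T.proj ⟨s, a⟩)
    (hy : y.1 = T.proj ⟨s, b⟩) : ∃ γ : Path x y, T.Lifts γ ⟨s, a⟩ ⟨s, b⟩ 1 := by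
  refine ⟨⟨⟨fun r => ⟨T.proj ⟨s, mix a b r⟩, h r⟩, ?_⟩, Subtype.ext ?_, Subtype.ext ?_⟩,
    Lifts.of_path (segment a b) fun r => rfl⟩
  · exact Continuous.subtype_mk
      (T.continuous_proj.comp (continuous_sigmaMk.comp (segment a b).continuous)) h
  · simp [hx]
  · simp [hy]

/-- A point of the normal slice to the face spanned by `F`, with equal coordinates on `A`. -/
lemma exists_slice_point {F A : Finset (Fin (n + 1))} (hF : F.Nonempty) (hA : A.Nonempty)
    (hFA : Disjoint F A) : ∃ b : stdSimplex ℝ (Fin (n + 1)),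
      (∀ j ∈ F, b j = (n / (n + 1) : ℝ) / F.card) ∧
      (∀ j ∈ A, b j = (1 / (n + 1) : ℝ) / A.card) ∧ ∀ j ∉ F, j ∉ A → b j = 0 := by
  classical
  have hF' : (F.card : ℝ) ≠ 0 := by simpa using hF.ne_empty
  have hA' : (A.card : ℝ) ≠ 0 := by simpa using hA.ne_empty
  have hn' : (n : ℝ) + 1 ≠ 0 := by positivity
  obtain ⟨b, e⟩ : ∃ b : stdSimplex ℝ (Fin (n + 1)), ∀ j,
      b j = (if j ∈ F then (n / (n + 1) : ℝ) / F.card else 0)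
        + if j ∈ A then (1 / (n + 1) : ℝ) / A.card else 0 := by
    refine ⟨⟨fun j => (if j ∈ F then (n / (n + 1) : ℝ) / F.card else 0)
        + if j ∈ A then (1 / (n + 1) : ℝ) / A.card else 0, fun j => ?_, ?_⟩, fun j => rfl⟩
    · dsimp only
      split_ifs <;> positivity
    · rw [Finset.sum_add_distrib, Finset.sum_ite_mem, Finset.sum_ite_mem, Finset.univ_inter,
        Finset.univ_inter, Finset.sum_const, Finset.sum_const, nsmul_eq_mul, nsmul_eq_mul]
      field_simp
  refine ⟨b, fun j hj => ?_, fun j hj => ?_, fun j hj hj' => ?_⟩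
  · rw [e, if_pos hj, if_neg (Finset.disjoint_left.mp hFA hj), add_zero]
  · rw [e, if_pos hj, if_neg (Finset.disjoint_right.mp hFA hj), zero_add]
  · rw [e, if_neg hj, if_neg hj', zero_add]

lemma Holonomy.proj_mem_link {F : Finset (Fin (n + 1))} {s t : ι}
    {g : Equiv.Perm (Fin (n + 1))} (H : T.Holonomy (F : Set _)ᶜ s t g)
    {b : stdSimplex ℝ (Fin (n + 1))} (hb : ∀ j ∈ F, b j = (n / (n + 1) : ℝ) / F.card) :
    T.proj ⟨t, relabel g b⟩ ∈ T.link s F := by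
  refine ⟨⟨t, relabel g b⟩, ⟨F.map g.toEmbedding, H.singlex_eq, fun i hi => ?_⟩, rfl⟩
  obtain ⟨i, hi', rfl⟩ := Finset.mem_map.mp hi
  change relabel g b (g i) = _
  rw [relabel_apply, hb i hi', Finset.card_map]

/-- In the slice the vertices of the face carry total weight `n / (n + 1) < 1`, so another
coordinate is nonzero and the point lies in an open face of larger dimension. -/
lemma link_subset_trivialLocus (hn : n ≠ 0) {F : Finset (Fin (n + 1))} (hF : F.Nonempty) (s : ι)
    (h : ∀ t (b : stdSimplex ℝ (Fin (n + 1))),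
      F.card < (Finset.univ.filter fun j => b j ≠ 0).card → T.LocallyTrivial t b) :
    T.link s F ⊆ T.trivialLocus := by
  rintro _ ⟨⟨t, b⟩, ⟨F', hF', hb⟩, rfl⟩
  refine ⟨t, b, h t b ?_, rfl⟩
  dsimp only at hF' hb
  obtain ⟨g, -, e⟩ := (singlex_eq_iff hF).mp hF'
  have hcard : F'.card = F.card := by rw [e, Finset.card_map]
  rw [← hcard]
  have h0 : (F'.card : ℝ) ≠ 0 := by
    rw [hcard]; simpa using hF.ne_empty
  have hn0 : (n : ℝ) ≠ 0 := by exact_mod_cast hn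
  have hn1 : (n : ℝ) + 1 ≠ 0 := by positivity
  refine Finset.card_lt_card ((Finset.ssubset_iff_subset_ne).mpr ⟨fun j hj => ?_, fun hne => ?_⟩)
  · rw [Finset.mem_filter]
    refine ⟨Finset.mem_univ _, ?_⟩
    rw [hb j hj]
    positivity
  · have h1 : ∑ j ∈ F', b j = 1 := by
      rw [← sum_eq_one b]
      refine Finset.sum_subset (Finset.subset_univ _) fun j _ hj => ?_
      by_contra hj'
      rw [hne] at hj
      exact hj (by simpa using hj')
    rw [Finset.sum_congr rfl hb, Finset.sum_const, nsmul_eq_mul] at h1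
    field_simp at h1
    linarith

/-- A facet path around a face lifts a path in the link of the face. -/
lemma Holonomy.exists_lifts_link {F : Finset (Fin (n + 1))} (hF : F.Nonempty)
    (hF' : F.card + 2 ≤ n) {s t : ι} {g : Equiv.Perm (Fin (n + 1))}
    (H : T.Holonomy (F : Set _)ᶜ s t g) {β : stdSimplex ℝ (Fin (n + 1))}
    (hβ : ∀ j ∈ F, β j = (n / (n + 1) : ℝ) / F.card) {x : T.link s F}
    (hx : x.1 = T.proj ⟨s, β⟩) :
    ∃ (y : T.link s F) (γ : Path x y), y.1 = T.proj ⟨t, relabel g β⟩ ∧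
      T.Lifts γ ⟨s, β⟩ ⟨t, relabel g β⟩ g := by
  classical
  induction H with
  | refl => exact ⟨x, Path.refl x, hx, Lifts.refl hx.symm⟩
  | @step t g H l hl ih =>
    obtain ⟨y, γ, hy, hγ⟩ := ih
    -- To cross the facet opposite to `l` inside the link, move within the slice from `β` to a point
    -- `δ` vanishing at `l`, change simplex there, and return to the copy of `β`. The codimension
    -- leaves vertices outside `F` other than `l` to carry the weight of `δ`.
    have hA : (Fᶜ.erase l).Nonempty := by
      rw [← Finset.card_pos, Finset.card_erase_of_mem (by simpa using hl), Finset.card_compl,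
        Fintype.card_fin]
      omega
    have hd : Disjoint F (Fᶜ.erase l) :=
      Finset.disjoint_left.mpr fun j hj hj' =>
        Finset.mem_compl.mp (Finset.mem_of_mem_erase hj') hj
    obtain ⟨δ, hδ, -, hδ0⟩ := exists_slice_point hF hA hd
    have hδl : relabel g δ (g l) = 0 := by
      rw [relabel_apply]
      exact hδ0 l (by simpa using hl) (by simp)
    have K : T.Holonomy {j | relabel g δ j = 0} t (T.adj t (g l)) (T.glue t (g l)) :=
      Holonomy.single hδl
    have hmix1 : ∀ r, ∀ j ∈ F, mix β δ r j = (n / (n + 1) : ℝ) / F.card := fun r j hj => by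
      rw [mix_apply, hβ j hj, hδ j hj]; ring
    have hmix2 : ∀ r, ∀ j ∈ F, mix δ β r j = (n / (n + 1) : ℝ) / F.card := fun r j hj => by
      rw [mix_apply, hβ j hj, hδ j hj]; ring
    have H' := H.step hl
    obtain ⟨γ₁, h₁⟩ := exists_lifts_segment (x := y)
      (y := (⟨_, H.proj_mem_link hδ⟩ : T.link s F))
      (fun r => relabel_mix g β δ r ▸ H.proj_mem_link (hmix1 r)) hy rfl
    obtain ⟨γ₂, h₂⟩ := exists_lifts_segment (x := (⟨_, H.proj_mem_link hδ⟩ : T.link s F))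
      (y := (⟨_, H'.proj_mem_link hβ⟩ : T.link s F))
      (a := relabel (T.glue t (g l) * g) δ)
      (fun r => relabel_mix (T.glue t (g l) * g) δ β r ▸ H'.proj_mem_link (hmix2 r))
      (K.proj_relabel _ fun _ h => h).symm rfl
    refine ⟨_, (γ.trans γ₁).trans γ₂, rfl, ?_⟩
    have := ((hγ.trans h₁).move K).trans h₂
    simpa using this

/-- The triangulation is locally trivial at a point in the relative interior of a face with a simply
connected link, if it is so at all points in the relative interiors of larger faces. -/
lemma locallyTrivial_of_link {s : ι} {a : stdSimplex ℝ (Fin (n + 1))}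
    {F : Finset (Fin (n + 1))} (ha : ∀ j, a j = 0 ↔ j ∉ F) (hF : F.Nonempty)
    (hF' : F.card + 2 ≤ n) (hlink : SimplyConnectedSpace (T.link s F))
    (h : ∀ t (b : stdSimplex ℝ (Fin (n + 1))),
      F.card < (Finset.univ.filter fun j => b j ≠ 0).card → T.LocallyTrivial t b) :
    T.LocallyTrivial s a := by
  intro g H hg
  have hZ : {j | a j = 0} = (F : Set (Fin (n + 1)))ᶜ := by ext j; simpa using ha j
  rw [hZ] at H
  have hmem : ∀ j, g j ∈ F ↔ j ∈ F := fun j => by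
    have := relabel_eq_iff.mp hg j
    rw [← not_iff_not, ← ha, ← ha, this]
  have hA : (Fᶜ).Nonempty := by
    rw [← Finset.card_pos, Finset.card_compl, Fintype.card_fin]; omega
  -- Being constant on `F` and on its complement, `β` is fixed by every permutation preserving `F`,
  -- so the path in the link closes up. It is interior to the simplex, hence locally trivial.
  obtain ⟨β, hβ, hβ', -⟩ := exists_slice_point hF hA disjoint_compl_right
  have hgβ : relabel g β = β := by
    rw [relabel_eq_iff]
    intro j
    by_cases hj : j ∈ F
    · rw [hβ _ hj, hβ _ ((hmem j).mpr hj)]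
    · rw [hβ' _ (Finset.mem_compl.mpr hj),
        hβ' _ (Finset.mem_compl.mpr fun h' => hj ((hmem j).mp h'))]
  have hpos : ∀ j, β j ≠ 0 := by
    intro j
    have h1 : (0 : ℝ) < n := by exact_mod_cast (by omega : 0 < n)
    by_cases hj : j ∈ F
    · rw [hβ _ hj]
      have : (0 : ℝ) < F.card := by exact_mod_cast hF.card_pos
      positivity
    · rw [hβ' _ (Finset.mem_compl.mpr hj)]
      have : (0 : ℝ) < (Fᶜ).card := by exact_mod_cast hA.card_pos
      positivity
  have hx : T.proj ⟨s, β⟩ ∈ T.link s F := by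
    simpa using (Holonomy.refl (T := T) (Z := (F : Set _)ᶜ) (s := s)).proj_mem_link hβ
  obtain ⟨y, γ, hy, hγ⟩ := H.exists_lifts_link hF hF' hβ (x := ⟨_, hx⟩) rfl
  rw [hgβ] at hy hγ
  exact hγ.eq_one_of_simplyConnected
    (link_subset_trivialLocus (by omega) hF s h) (locallyTrivial_of_pos hpos) rfl hy.symm

/-- Under the hypotheses on the links, an even triangulation is locally trivial away from its
vertices. -/
lemma locallyTrivial_of_isEven [Finite ι] (hn : 3 ≤ n) (hT : T.IsEven)
    (hT' : 4 ≤ n → T.InjectiveOnInteriors ∧ T.LinksSimplyConnected) (s : ι)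
    (a : stdSimplex ℝ (Fin (n + 1))) (ha : ∀ j, a j < 1) : T.LocallyTrivial s a := by
  classical
  -- Strong induction on the codimension `k`. For `k ≥ 3` at least two nonzero coordinates force `n
  -- ≥ 4`, so the hypothesis on links is available.
  have key : ∀ (k : ℕ) (s : ι) (a : stdSimplex ℝ (Fin (n + 1))),
      (Finset.univ.filter fun j => a j = 0).card = k →
      2 ≤ (Finset.univ.filter fun j => a j ≠ 0).card → T.LocallyTrivial s a := by
    intro k
    induction k using Nat.strong_induction_on with
    | _ k ih =>
      intro s a hk h2
      have hsum : ∀ b : stdSimplex ℝ (Fin (n + 1)), (Finset.univ.filter fun j => b j = 0).card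
          + (Finset.univ.filter fun j => b j ≠ 0).card = n + 1 := fun b => by
        rw [Finset.card_filter_add_card_filter_not, Finset.card_univ, Fintype.card_fin]
      have hka := hsum a
      rcases lt_or_ge k 3 with h3 | h3
      · interval_cases k
        · refine locallyTrivial_of_pos fun j hj => ?_
          rw [Finset.card_eq_zero] at hk
          exact Finset.notMem_empty j (hk ▸ by simpa using hj)
        · obtain ⟨i, hi⟩ := Finset.card_eq_one.mp hk
          refine locallyTrivial_of_facet (i := i) fun j => ?_
          have := congrArg (fun A => j ∈ A) hi
          simpa using this
        · obtain ⟨i, j, hij, hi⟩ := Finset.card_eq_two.mp hk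
          refine locallyTrivial_of_codim_two hn hT (fun h => (hT' h).1) hij fun l => ?_
          have := congrArg (fun A => l ∈ A) hi
          simpa using this
      · have hF' : (Finset.univ.filter fun j => a j ≠ 0).card + 2 ≤ n := by omega
        refine locallyTrivial_of_link (F := Finset.univ.filter fun j => a j ≠ 0)
          (fun j => by simp) (Finset.card_pos.mp (by omega)) hF'
          ((hT' (by omega)).2 s _ h2 hF') fun t b hb => ?_
        have hkb := hsum b
        exact ih _ (by omega) t b rfl (by omega)
  refine key _ s a rfl ?_
  by_contra hlt
  have h1 := sum_eq_one a
  rw [← Finset.sum_filter_ne_zero] at h1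
  have h2 : (Finset.univ.filter fun j => a j ≠ 0).card ≤ 1 := by omega
  rcases Finset.card_le_one_iff_subset_singleton.mp h2 with ⟨j, hj⟩
  rcases Finset.subset_singleton_iff.mp hj with e | e <;> rw [e] at h1
  · simp at h1
  · rw [Finset.sum_singleton] at h1
    exact (ha j).ne h1

/-! ### The canonical symmetric representation -/

lemma proj_mem_skeleton_zero_iff {s : ι} {a : stdSimplex ℝ (Fin (n + 1))} :
    T.proj ⟨s, a⟩ ∈ T.skeleton 0 ↔ ∃ j, a j = 1 := by
  refine ⟨fun h => T.exists_eq_one_of_mem_skeleton_zero h, ?_⟩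
  rintro ⟨j, hj⟩
  simp only [skeleton, Set.mem_iUnion]
  refine ⟨s, {j}, rfl, ⟨s, a⟩, ⟨rfl, fun i hi => ?_⟩, rfl⟩
  change a i = 0
  have h1 := sum_eq_one a
  rw [← Finset.add_sum_erase _ _ (Finset.mem_univ j), hj, add_eq_left,
    Finset.sum_eq_zero_iff_of_nonneg fun k _ => stdSimplex.zero_le a k] at h1
  exact h1 i (Finset.mem_erase.mpr ⟨by simpa using hi, Finset.mem_univ _⟩)

lemma proj_mem_compl_skeleton_zero_iff {s : ι} {a : stdSimplex ℝ (Fin (n + 1))} :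
    T.proj ⟨s, a⟩ ∈ (T.skeleton 0)ᶜ ↔ ∀ j, a j < 1 := by
  rw [Set.mem_compl_iff, proj_mem_skeleton_zero_iff, not_exists]
  exact forall_congr' fun j => ⟨fun h => lt_of_le_of_ne (stdSimplex.le_one a j) h, fun h => h.ne⟩

lemma relabel_glue_facetBarycenter (hn : 3 ≤ n) (s : ι) (i : Fin (n + 1)) :
    relabel (T.glue s i) (facetBarycenter hn i) = facetBarycenter hn (T.glue s i i) := by
  rw [relabel_eq_iff]
  intro j
  change (if T.glue s i j = T.glue s i i then (0 : ℝ) else _) = if j = i then 0 else _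
  simp

lemma facetBarycenter_self (hn : 3 ≤ n) (i : Fin (n + 1)) : facetBarycenter hn i i = 0 := by
  change (if i = i then (0 : ℝ) else _) = 0
  simp

lemma lifts_halfEdge (hn : 3 ≤ n) (s : ι) (i : Fin (n + 1)) :
    T.Lifts (T.halfEdge hn s i) ⟨s, barycenter⟩ ⟨s, facetBarycenter hn i⟩ 1 :=
  Lifts.of_path ⟨⟨spoke hn i, continuous_spoke hn i⟩, spoke_zero hn i, spoke_one hn i⟩
    fun _ => rfl

lemma lifts_dualEdge (hn : 3 ≤ n) (s : ι) (i : Fin (n + 1)) :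
    T.Lifts (T.dualEdge hn s i) ⟨s, barycenter⟩ ⟨T.adj s i, barycenter⟩ (T.glue s i) := by
  have h1 := (lifts_halfEdge (T := T) hn s i).move
    (Holonomy.single (T := T) (s := s) (i := i) (facetBarycenter_self hn i))
  rw [relabel_glue_facetBarycenter] at h1
  have h2 := (lifts_halfEdge (T := T) hn (T.adj s i) (T.glue s i i)).symm.cast
    (T.facetCenter_adj hn s i).symm rfl
  have e : 1⁻¹ * (T.glue s i * 1) = T.glue s i := by simp
  exact e ▸ h1.trans h2

lemma FacetPath.lifts_dualPath (hn : 3 ≤ n) {s t : ι} (γ : T.FacetPath s t) :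
    T.Lifts (γ.dualPath hn) ⟨s, barycenter⟩ ⟨t, barycenter⟩ γ.projectivity := by
  induction γ with
  | nil s => exact Lifts.refl rfl
  | cons s i γ ih => exact (lifts_dualEdge hn s i).trans ih

lemma barycenter_ne_zero (j : Fin (n + 1)) :
    (barycenter : stdSimplex ℝ (Fin (n + 1))) j ≠ 0 := by
  have h : (barycenter : stdSimplex ℝ (Fin (n + 1))) j = (Fintype.card (Fin (n + 1)) : ℝ)⁻¹ :=
    barycenter_apply j
  rw [h]
  simp only [Fintype.card_fin]
  positivity

variable (T) in
/-- The fibre of the covering over the barycentre of a simplex is the set of its vertices. -/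
def fiberEquiv (hn : 3 ≤ n) (s : ι) :
    Fin (n + 1) ≃ ((T.skeleton 0)ᶜ.restrictPreimage T.coverProj ⁻¹' {T.center hn s}) :=
  Equiv.ofBijective (fun v => ⟨⟨T.coverMk ⟨s, barycenter⟩ v, (T.center hn s).2⟩, rfl⟩) <| by
    refine ⟨fun v w h => ?_, fun ⟨⟨e, he⟩, h⟩ => ?_⟩
    · exact (locallyTrivial_of_pos (T := T) (s := s) barycenter_ne_zero).coverMk_injective
        (congrArg (fun e => e.1.1) h)
    · obtain ⟨⟨⟨t, b⟩, v⟩, rfl⟩ := Quot.exists_rep e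
      have h1 : T.proj ⟨s, barycenter⟩ = T.proj ⟨t, b⟩ := (congrArg Subtype.val h).symm
      obtain ⟨g, hg, e⟩ := proj_eq_iff.mp h1
      have hZ : {j | (barycenter : stdSimplex ℝ (Fin (n + 1))) j = 0} = ∅ := by
        ext j; simpa using barycenter_ne_zero j
      rw [hZ] at hg
      obtain ⟨rfl, rfl⟩ := hg.eq_one_of_empty
      rw [relabel_one] at e
      subst e
      exact ⟨v, rfl⟩

/-- The canonical symmetric representation exists if the triangulation is locally trivial away from
its vertices. -/
lemma exists_isCanonicalRepresentation (hn : 3 ≤ n)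
    (hT : ∀ (s : ι) (a : stdSimplex ℝ (Fin (n + 1))), (∀ j, a j < 1) → T.LocallyTrivial s a)
    (s : ι) : ∃ ρ, T.IsCanonicalRepresentation hn s ρ := by
  have hS : (T.skeleton 0)ᶜ ⊆ T.trivialLocus := by
    intro x hx
    obtain ⟨s, a, rfl⟩ := exists_rep x
    exact ⟨s, a, hT s a (proj_mem_compl_skeleton_zero_iff.mp hx), rfl⟩
  -- The representation is the monodromy, transported from the fibre to the vertices of the simplex.
  refine ⟨((T.fiberEquiv hn s).symm.permCongrHom.toMonoidHom).comp
    ((isCoveringMap_restrictPreimage hS).monodromyPerm (T.center hn s)), fun γ => ?_⟩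
  ext1 v
  change (T.fiberEquiv hn s).symm ((isCoveringMap_restrictPreimage hS).monodromy
    (.mk (γ.dualPath hn)) (T.fiberEquiv hn s v)) = γ.projectivity v
  rw [Equiv.symm_apply_eq]
  exact (γ.lifts_dualPath hn).monodromy_eq hS v (hxS := (T.center hn s).2)
    (hyS := (T.center hn s).2) rfl rfl

/-! ### Paths in a simplex without its vertices -/

/-- The standard simplex without its vertices. -/
abbrev Core (n : ℕ) : Type := {a : stdSimplex ℝ (Fin (n + 1)) // ∀ j, a j < 1}

namespace Core

/-- The straight segment in the simplex without its vertices. -/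
def mix (a b : Core n) (r : unitInterval) : Core n :=
  ⟨stdSimplex.mix a.1 b.1 r, fun j => by
    rw [mix_apply]
    have h1 := a.2 j
    have h2 := b.2 j
    have h3 := r.2.1
    have h4 := r.2.2
    rcases h4.lt_or_eq with h | h
    · nlinarith
    · rw [h]; linarith⟩

lemma continuous_mix :
    Continuous fun p : (Core n × Core n) × unitInterval => mix p.1.1 p.1.2 p.2 := by
  refine Continuous.subtype_mk (stdSimplex.continuous_mix.comp
    (by fun_prop : Continuous fun p : (Core n × Core n) × unitInterval =>
      ((p.1.1.1, p.1.2.1), p.2))) _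

/-- The straight segment in the simplex without its vertices, as a path. -/
def segment (a b : Core n) : Path a b where
  toFun := mix a b
  continuous_toFun := continuous_mix.comp
    (by fun_prop : Continuous fun r : unitInterval => ((a, b), r))
  source' := Subtype.ext (mix_zero _ _)
  target' := Subtype.ext (mix_one _ _)

/-- Vertices are extreme points, so the simplex without them is still convex and contracts along
segments. -/
instance (a b : Core n) : Subsingleton (Path.Homotopic.Quotient a b) := by
  have : ContractibleSpace (Core n) := by
    rw [contractible_iff_id_nullhomotopic]
    refine ⟨a, ⟨⟨⟨fun p => mix p.2 a p.1, ?_⟩, fun x => ?_, fun x => ?_⟩⟩⟩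
    · exact continuous_mix.comp (by fun_prop :
        Continuous fun p : unitInterval × Core n => ((p.2, a), p.1))
    · exact Subtype.ext (mix_zero _ _)
    · exact Subtype.ext (mix_one _ _)
  infer_instance

/-- Relabelling of the vertices. -/
def relabel (g : Equiv.Perm (Fin (n + 1))) (a : Core n) : Core n :=
  ⟨stdSimplex.relabel g a.1, fun _ => a.2 _⟩

end Core

variable (T) in
/-- The map of a simplex without its vertices to the complement of the vertices. -/
def pt (s : ι) : C(Core n, T.Punctured) where
  toFun a := ⟨T.proj ⟨s, a.1⟩, proj_mem_compl_skeleton_zero_iff.mpr a.2⟩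
  continuous_toFun := Continuous.subtype_mk
    (T.continuous_proj.comp (continuous_sigmaMk.comp continuous_subtype_val)) _

lemma exists_pt_eq (x : T.Punctured) : ∃ s a, T.pt s a = x := by
  obtain ⟨x, hx⟩ := x
  obtain ⟨s, a, rfl⟩ := exists_rep x
  exact ⟨s, ⟨a, proj_mem_compl_skeleton_zero_iff.mp hx⟩, rfl⟩

variable (T) in
/-- The class of the paths between two points of a simplex without its vertices. -/
def line (s : ι) (a b : Core n) : Path.Homotopic.Quotient (T.pt s a) (T.pt s b) :=
  (Path.Homotopic.Quotient.mk (Core.segment a b)).map (T.pt s)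

lemma map_eq_line (s : ι) {a b : Core n} (p : Path.Homotopic.Quotient a b) :
    p.map (T.pt s) = T.line s a b := by
  rw [line, Subsingleton.elim p]

lemma line_trans_line (s : ι) (a b c : Core n) :
    (T.line s a b).trans (T.line s b c) = T.line s a c := by
  rw [← map_eq_line s ((Path.Homotopic.Quotient.mk (Core.segment a b)).trans
    (.mk (Core.segment b c)))]
  exact congrArg Path.Homotopic.Quotient.mk (Path.map_trans _ _ (T.pt s).continuous).symm

lemma Holonomy.pt_eq {s t : ι} {g : Equiv.Perm (Fin (n + 1))} {a : Core n}
    (H : T.Holonomy {j | a.1 j = 0} s t g) : T.pt t (a.relabel g) = T.pt s a :=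
  Subtype.ext (H.proj_relabel a.1 fun _ h => h)

/-- Segments in a facet of one simplex are segments in the other one. -/
lemma line_relabel_cast {s : ι} {i : Fin (n + 1)} {a b : Core n} (ha : a.1 i = 0) (hb : b.1 i = 0)
    (ha' : T.pt s a = T.pt (T.adj s i) (a.relabel (T.glue s i)))
    (hb' : T.pt s b = T.pt (T.adj s i) (b.relabel (T.glue s i))) :
    (T.line (T.adj s i) (a.relabel (T.glue s i)) (b.relabel (T.glue s i))).cast ha' hb'
      = T.line s a b := by
  refine congrArg Path.Homotopic.Quotient.mk ?_
  ext r
  have h : (stdSimplex.mix a.1 b.1 r) i = 0 := by rw [mix_apply, ha, hb]; simp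
  exact (Holonomy.single (T := T) (Z := {j | (stdSimplex.mix a.1 b.1 r) j = 0}) (s := s)
    h).proj_relabel _ fun _ h => h

variable (n) in
/-- The barycentre. -/
def Core.bary (hn : 3 ≤ n) : Core n :=
  ⟨barycenter, fun j => by
    have h : (barycenter : stdSimplex ℝ (Fin (n + 1))) j = (Fintype.card (Fin (n + 1)) : ℝ)⁻¹ :=
      barycenter_apply j
    rw [h, Fintype.card_fin]
    have : (3 : ℝ) ≤ n := by exact_mod_cast hn
    refine inv_lt_one_of_one_lt₀ ?_
    push_cast
    linarith⟩

/-- The barycentre of a facet. -/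
def Core.facetBary (hn : 3 ≤ n) (i : Fin (n + 1)) : Core n :=
  ⟨facetBarycenter hn i, fun j => by
    change (if j = i then (0 : ℝ) else (n : ℝ)⁻¹) < 1
    have : (3 : ℝ) ≤ n := by exact_mod_cast hn
    split_ifs
    · norm_num
    · exact inv_lt_one_of_one_lt₀ (by linarith)⟩

variable (T) in
/-- The class of the paths in a simplex from its barycentre to `a`. -/
def hub (hn : 3 ≤ n) (s : ι) (a : Core n) :
    Path.Homotopic.Quotient (T.center hn s) (T.pt s a) :=
  T.line s (Core.bary n hn) a

lemma hub_trans_line (hn : 3 ≤ n) (s : ι) (a b : Core n) :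
    (T.hub hn s a).trans (T.line s a b) = T.hub hn s b :=
  line_trans_line _ _ _ _

lemma mk_halfEdge (hn : 3 ≤ n) (s : ι) (i : Fin (n + 1)) :
    Path.Homotopic.Quotient.mk (T.halfEdge hn s i) = T.hub hn s (Core.facetBary hn i) := by
  let p : Path (Core.bary n hn) (Core.facetBary hn i) :=
    { toFun r := ⟨spoke hn i r, proj_mem_compl_skeleton_zero_iff.mp (T.proj_spoke_notMem hn s i r)⟩
      continuous_toFun := (continuous_spoke hn i).subtype_mk _
      source' := Subtype.ext (spoke_zero hn i)
      target' := Subtype.ext (spoke_one hn i) }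
  exact map_eq_line (T := T) s (Path.Homotopic.Quotient.mk p)

/-! ### Cancellation in the fundamental groupoid, with transport along equal end points. -/

section Groupoid

variable {X : Type*} [TopologicalSpace X]

lemma quotient_symm_trans {x y z : X} (A : Path.Homotopic.Quotient x y)
    (B : Path.Homotopic.Quotient y z) : (A.trans B).symm = B.symm.trans A.symm := by
  induction A using Path.Homotopic.Quotient.ind
  induction B using Path.Homotopic.Quotient.ind
  rw [← Path.Homotopic.Quotient.mk_trans, ← Path.Homotopic.Quotient.mk_symm, Path.trans_symm]
  rfl

lemma quotient_symm_cast_trans {u x y z : X} (hx : x = y) (A : Path.Homotopic.Quotient u z)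
    (L : Path.Homotopic.Quotient z y) :
    (L.symm.cast hx rfl).trans A.symm = (A.trans L).symm.cast hx rfl := by
  subst hx
  rw [Path.Homotopic.Quotient.cast_rfl_rfl, Path.Homotopic.Quotient.cast_rfl_rfl,
    quotient_symm_trans]

/-- Inserting a path and its inverse slides the point where two arcs meet; used to move a crossing
point within a facet. -/
lemma quotient_trans_cast_symm {w w' x x' y y' : X} (hx : x = x') (hy : y = y')
    (A : Path.Homotopic.Quotient w y) (L : Path.Homotopic.Quotient y x)
    (B : Path.Homotopic.Quotient w' y') (L' : Path.Homotopic.Quotient y' x')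
    (h : L'.cast hy hx = L) :
    A.trans (B.symm.cast hy rfl) = (A.trans L).trans ((B.trans L').symm.cast hx rfl) := by
  subst hx hy
  rw [Path.Homotopic.Quotient.cast_rfl_rfl] at h
  subst h
  rw [Path.Homotopic.Quotient.cast_rfl_rfl, Path.Homotopic.Quotient.cast_rfl_rfl,
    quotient_symm_trans,
    Path.Homotopic.Quotient.trans_assoc, ← Path.Homotopic.Quotient.trans_assoc L',
    Path.Homotopic.Quotient.trans_symm, Path.Homotopic.Quotient.refl_trans]

lemma quotient_trans_cast_symm_trans {u v w x y z : X} (hx : x = y) (hy : y = z)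
    (A : Path.Homotopic.Quotient u x) (B : Path.Homotopic.Quotient v y)
    (C : Path.Homotopic.Quotient w z) :
    (A.trans (B.symm.cast hx rfl)).trans (B.trans (C.symm.cast hy rfl))
      = A.trans (C.symm.cast (hx.trans hy) rfl) := by
  subst hx hy
  rw [Path.Homotopic.Quotient.cast_rfl_rfl, Path.Homotopic.Quotient.cast_rfl_rfl,
    Path.Homotopic.Quotient.trans_assoc, ← Path.Homotopic.Quotient.trans_assoc B.symm,
    Path.Homotopic.Quotient.symm_trans, Path.Homotopic.Quotient.refl_trans]

end Groupoid

/-- The edge may cross its facet at any point `a` instead of the barycentre: the segment joining the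
two crossing points lies in the facet and is the same seen from either side. -/
lemma mk_dualEdge (hn : 3 ≤ n) (s : ι) (i : Fin (n + 1)) {a : Core n} (ha : a.1 i = 0)
    (h : T.pt s a = T.pt (T.adj s i) (a.relabel (T.glue s i))) :
    Path.Homotopic.Quotient.mk (T.dualEdge hn s i) = (T.hub hn s a).trans
      ((T.hub hn (T.adj s i) (a.relabel (T.glue s i))).symm.cast h rfl) := by
  have key : ∀ (b : Core n) (_ : b = Core.facetBary hn (T.glue s i i))
      (h : T.pt s (Core.facetBary hn i) = T.pt (T.adj s i) b),
      Path.Homotopic.Quotient.mk (T.dualEdge hn s i) = (T.hub hn s (Core.facetBary hn i)).trans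
        ((T.hub hn (T.adj s i) b).symm.cast h rfl) := by
    rintro b rfl h
    rw [← mk_halfEdge, ← mk_halfEdge]
    rfl
  have h0 : (Core.facetBary hn i).1 i = 0 := facetBarycenter_self hn i
  have h1 : T.pt s (Core.facetBary hn i)
      = T.pt (T.adj s i) ((Core.facetBary hn i).relabel (T.glue s i)) :=
    (Holonomy.single (T := T) (Z := {j | (Core.facetBary hn i).1 j = 0}) h0).pt_eq.symm
  rw [key ((Core.facetBary hn i).relabel (T.glue s i))
    (Subtype.ext (relabel_glue_facetBarycenter hn s i)) h1,
    quotient_trans_cast_symm h h1 _ _ _ _ (line_relabel_cast h0 ha h1 h),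
    hub_trans_line, hub_trans_line]

lemma FacetPath.mk_dualPath_append (hn : 3 ≤ n) {s t u : ι} (γ : T.FacetPath s t)
    (δ : T.FacetPath t u) : Path.Homotopic.Quotient.mk ((γ.append δ).dualPath hn)
      = (Path.Homotopic.Quotient.mk (γ.dualPath hn)).trans (.mk (δ.dualPath hn)) := by
  induction γ with
  | nil s => exact (Path.Homotopic.Quotient.refl_trans _).symm
  | cons s i γ ih =>
    simp only [append, dualPath, Path.Homotopic.Quotient.mk_trans, ih,
      Path.Homotopic.Quotient.trans_assoc]

/-- Close to a point, the paths through this point are homotopic to dual paths. -/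
lemma Holonomy.exists_mk_dualPath (hn : 3 ≤ n) {s t : ι} {g : Equiv.Perm (Fin (n + 1))} {a : Core n}
    (H : T.Holonomy {j | a.1 j = 0} s t g) :
    ∃ (φ : T.FacetPath s t) (h : T.pt s a = T.pt t (a.relabel g)),
      Path.Homotopic.Quotient.mk (φ.dualPath hn)
        = (T.hub hn s a).trans ((T.hub hn t (a.relabel g)).symm.cast h rfl) := by
  induction H with
  | refl =>
    exact ⟨.nil s, rfl, (Path.Homotopic.Quotient.trans_symm _).symm⟩
  | @step t g H l hl ih =>
    obtain ⟨φ, h, e⟩ := ih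
    have hl' : (a.relabel g).1 (g l) = 0 := (relabel_apply g a.1 l).trans hl
    have h1 : T.pt t (a.relabel g)
        = T.pt (T.adj t (g l)) ((a.relabel g).relabel (T.glue t (g l))) :=
      (Holonomy.single (T := T) (Z := {j | (a.relabel g).1 j = 0}) hl').pt_eq.symm
    refine ⟨φ.append (.cons t (g l) (.nil _)), h.trans h1, ?_⟩
    have e2 : Path.Homotopic.Quotient.mk
        ((FacetPath.cons t (g l) (.nil _) : T.FacetPath t _).dualPath hn)
        = .mk (T.dualEdge hn t (g l)) := by
      rw [FacetPath.dualPath, FacetPath.dualPath, Path.Homotopic.Quotient.mk_trans,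
        Path.Homotopic.Quotient.mk_refl, Path.Homotopic.Quotient.trans_refl]
    rw [FacetPath.mk_dualPath_append, e, e2, mk_dualEdge hn t (g l) hl' h1]
    exact quotient_trans_cast_symm_trans h h1 _ _ _

/-! ### Star neighbourhoods are contractible -/

section Star

variable {s : ι} {a : stdSimplex ℝ (Fin (n + 1))} {ε : ℝ}

lemma Near.mix {b : T.Simplices} {g : Equiv.Perm (Fin (n + 1))} (H : T.Near s a ε b g)
    (r : unitInterval) : T.Near s a ε ⟨b.1, stdSimplex.mix b.2 (relabel g a) r⟩ g := by
  refine ⟨H.holonomy, fun j => ?_⟩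
  have h1 := H.abs_lt j
  change |stdSimplex.mix b.2 (relabel g a) r (g j) - a j| < ε
  rw [mix_apply, relabel_apply,
    show (1 - (r : ℝ)) * b.2 (g j) + r * a j - a j = (1 - r) * (b.2 (g j) - a j) by ring, abs_mul,
    abs_of_nonneg (sub_nonneg.mpr r.2.2)]
  have h2 := r.2.1
  nlinarith [abs_nonneg (b.2 (g j) - a j)]

variable (T) in
/-- Move the points of all simplices on straight segments towards `c`. -/
def moveTo (c : stdSimplex ℝ (Fin (n + 1))) : C(T.Simplices, C(unitInterval, T.Space)) where
  toFun b := ⟨fun r => T.proj ⟨b.1, mix b.2 c r⟩, T.continuous_proj.comp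
    (continuous_sigmaMk.comp (segment b.2 c).continuous)⟩
  continuous_toFun := by
    refine continuous_sigma fun t => ?_
    refine ContinuousMap.continuous_of_continuous_uncurry _ ?_
    exact T.continuous_proj.comp (continuous_sigmaMk.comp (continuous_mix.comp
      (by fun_prop : Continuous fun p : stdSimplex ℝ (Fin (n + 1)) × unitInterval =>
        ((p.1, c), p.2))))

lemma moveTo_apply (c : stdSimplex ℝ (Fin (n + 1))) (b : T.Simplices) (r : unitInterval) :
    T.moveTo c b r = T.proj ⟨b.1, mix b.2 c r⟩ := rfl

/-- Straight contraction towards the centre respects the gluing, because a coordinate vanishing at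
`b` vanishes at the nearby copy of the centre and so all along the segment. -/
lemma Near.moveTo_eq (hε : Separates a ε) {b b' : T.Simplices} {g g' : Equiv.Perm (Fin (n + 1))}
    (H : T.Near s a ε b g) (H' : T.Near s a ε b' g') (h : T.proj b = T.proj b') :
    T.moveTo (relabel g a) b = T.moveTo (relabel g' a) b' := by
  obtain ⟨t, b⟩ := b
  obtain ⟨t', b'⟩ := b'
  obtain ⟨k, hk, rfl⟩ := proj_eq_iff.mp h
  rw [H'.relabel_eq_relabel hε (H.move hε hk rfl)]
  ext r
  rw [moveTo_apply, moveTo_apply, relabel_mul, ← relabel_mix]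
  refine (hk.proj_relabel _ fun l hl => ?_).symm
  rw [mix_apply, hl]
  obtain ⟨l, rfl⟩ := g.surjective l
  rw [relabel_apply, H.eq_zero hε hl]
  simp

/-- The open star neighbourhoods are contractible. -/
lemma contractibleSpace_star (hε : Separates a ε) : ContractibleSpace (T.star s a ε) := by
  have hex : ∀ x : T.star s a ε, ∃ f : C(unitInterval, T.Space), ∀ b g, T.proj b = x →
      T.Near s a ε b g → f = T.moveTo (relabel g a) b := by
    rintro ⟨_, b, ⟨g, hg⟩, rfl⟩
    exact ⟨_, fun b' g' h h' => hg.moveTo_eq hε h' h.symm⟩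
  choose f hf using hex
  have hcont : Continuous f := by
    -- Continuity is tested on the simplices, by restricting the quotient map to the open star.
    -- There `f` agrees, near each point, with the contraction towards a fixed copy of the centre.
    have hq : IsQuotientMap ((T.star s a ε).restrictPreimage T.proj) :=
      (isQuotientMap_quot_mk (r := T.Rel)).restrictPreimage_isOpen (isOpen_star hε)
    rw [hq.continuous_iff, continuous_iff_continuousAt]
    rintro ⟨b, hb⟩
    obtain ⟨g, hg⟩ := (proj_mem_star_iff hε).mp hb
    have hev : ∀ᶠ b' : T.proj ⁻¹' T.star s a ε in 𝓝 ⟨b, hb⟩, T.Near s a ε b'.1 g :=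
      ((isOpen_near s a ε g).preimage continuous_subtype_val).mem_nhds hg
    refine ContinuousAt.congr (f := fun b' => T.moveTo (relabel g a) b'.1) ?_ ?_
    · exact ((T.moveTo (relabel g a)).continuous.comp continuous_subtype_val).continuousAt
    · filter_upwards [hev] with b' hb'
      exact (hf _ b'.1 g rfl hb').symm
  have hrep : ∀ x : T.star s a ε, ∃ b g, T.proj b = x ∧ T.Near s a ε b g := by
    rintro ⟨_, b, ⟨g, hg⟩, rfl⟩
    exact ⟨b, g, rfl, hg⟩
  have hmem : ∀ p : unitInterval × T.star s a ε, f p.2 p.1 ∈ T.star s a ε := by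
    rintro ⟨r, x⟩
    obtain ⟨b, g, hb, hg⟩ := hrep x
    rw [hf x b g hb hg]
    exact ⟨_, ⟨g, hg.mix r⟩, rfl⟩
  rw [contractible_iff_id_nullhomotopic]
  refine ⟨⟨_, proj_mem_star_self hε⟩, ⟨⟨⟨fun p => ⟨f p.2 p.1, hmem p⟩, ?_⟩, fun x => ?_,
    fun x => ?_⟩⟩⟩
  · refine Continuous.subtype_mk ?_ hmem
    exact (hcont.comp continuous_snd).eval continuous_fst
  · obtain ⟨b, g, hb, hg⟩ := hrep x
    refine Subtype.ext ?_
    change f x 0 = x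
    rw [hf x b g hb hg, moveTo_apply, mix_zero, ← hb]
  · obtain ⟨b, g, hb, hg⟩ := hrep x
    refine Subtype.ext ?_
    change f x 1 = T.proj ⟨s, a⟩
    rw [hf x b g hb hg, moveTo_apply, mix_one]
    exact hg.holonomy.proj_relabel a fun _ h => h

end Star

lemma star_subset {s : ι} {a : Core n} {ε : ℝ} (hε : Separates a.1 ε) :
    T.star s a.1 ε ⊆ (T.skeleton 0)ᶜ := by
  rintro _ ⟨b, ⟨g, hg⟩, rfl⟩
  exact proj_mem_compl_skeleton_zero_iff.mpr (hg.lt_one hε a.2)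

/-- A path inside a star neighbourhood is homotopic to a path through the centre. -/
lemma mk_eq_of_mem_star {s₀ s t : ι} {a : Core n} {ε : ℝ} (hε : Separates a.1 ε) {b b' : Core n}
    {g g' : Equiv.Perm (Fin (n + 1))} (H : T.Near s₀ a.1 ε ⟨s, b.1⟩ g)
    (H' : T.Near s₀ a.1 ε ⟨t, b'.1⟩ g') (γ : Path (T.pt s b) (T.pt t b'))
    (hγ : ∀ r, (γ r).1 ∈ T.star s₀ a.1 ε) (h : T.pt s (a.relabel g) = T.pt t (a.relabel g')) :
    Path.Homotopic.Quotient.mk γ = (T.line s b (a.relabel g)).trans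
      ((T.line t b' (a.relabel g')).symm.cast h rfl) := by
  have := contractibleSpace_star (T := T) (s := s₀) hε
  let incl : C(T.star s₀ a.1 ε, T.Punctured) :=
    ⟨Set.inclusion (star_subset hε), continuous_inclusion _⟩
  have hc : ∀ {u : ι} {c : Core n} {k : Equiv.Perm (Fin (n + 1))},
      T.Near s₀ a.1 ε ⟨u, c.1⟩ k → ∀ r : unitInterval,
        T.proj ⟨u, (Core.mix c (a.relabel k) r).1⟩ ∈ T.star s₀ a.1 ε :=
    fun hk r => ⟨_, ⟨_, hk.mix r⟩, rfl⟩
  let P : ∀ {u : ι} {c : Core n} {k : Equiv.Perm (Fin (n + 1))}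
      (hk : T.Near s₀ a.1 ε ⟨u, c.1⟩ k),
      Path (⟨T.proj ⟨u, c.1⟩, ⟨_, ⟨k, hk⟩, rfl⟩⟩ : T.star s₀ a.1 ε)
        ⟨T.proj ⟨u, (a.relabel k).1⟩, by simpa [Core.mix, Core.relabel] using hc hk 1⟩ :=
    fun {u c k} hk =>
    { toFun r := ⟨T.proj ⟨u, (Core.mix c (a.relabel k) r).1⟩, hc hk r⟩
      continuous_toFun := Continuous.subtype_mk (T.continuous_proj.comp (continuous_sigmaMk.comp
        (continuous_subtype_val.comp (Core.segment c (a.relabel k)).continuous))) _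
      source' := Subtype.ext (by simp [Core.mix])
      target' := Subtype.ext (by simp [Core.mix]) }
  have h0 : (γ 0).1 = T.proj ⟨s, b.1⟩ := by rw [γ.source]; rfl
  have h1 : (γ 1).1 = T.proj ⟨t, b'.1⟩ := by rw [γ.target]; rfl
  have hp : T.proj ⟨s, (a.relabel g).1⟩ = T.proj ⟨t, (a.relabel g').1⟩ :=
    congrArg (fun z : T.Punctured => z.1) h
  let γ' : Path (⟨T.proj ⟨s, b.1⟩, ⟨_, ⟨g, H⟩, rfl⟩⟩ : T.star s₀ a.1 ε)
      ⟨T.proj ⟨t, b'.1⟩, ⟨_, ⟨g', H'⟩, rfl⟩⟩ :=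
    { toFun r := ⟨(γ r).1, hγ r⟩
      continuous_toFun := Continuous.subtype_mk (continuous_subtype_val.comp γ.continuous) _
      source' := Subtype.ext h0
      target' := Subtype.ext h1 }
  -- Both paths lie in the star and have the same end points; the star is contractible, so they are
  -- homotopic.
  have e1 : Path.Homotopic.Quotient.mk γ' = .mk ((P H).trans ((P H').symm.cast
      (Subtype.ext hp) rfl)) := Subsingleton.elim _ _
  have e2 := congrArg (fun q => q.map incl) e1
  have e3 := congrArg Path.Homotopic.Quotient.mk (Path.map_trans (P H) ((P H').symm.cast
      (Subtype.ext hp) rfl) incl.continuous)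
  exact e2.trans e3

/-! ### All paths are homotopic to dual paths -/

/-- A class of paths which becomes the class of a dual path, when its end points are joined to the
barycentres of simplices containing them. -/
def IsDual (hn : 3 ≤ n) {x y : T.Punctured} (γ : Path.Homotopic.Quotient x y) : Prop :=
  ∀ (s : ι) (a : Core n) (t : ι) (b : Core n) (hx : T.pt s a = x) (hy : T.pt t b = y),
    ∃ φ : T.FacetPath s t, Path.Homotopic.Quotient.mk (φ.dualPath hn)
      = ((T.hub hn s a).trans (γ.cast hx hy)).trans (T.hub hn t b).symm

/-- `IsDual` quantifies over all representatives of the end points, so the same one can be used on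
both sides of the middle point, where the two connecting arcs cancel. -/
lemma IsDual.trans {hn : 3 ≤ n} {x y z : T.Punctured} {γ : Path.Homotopic.Quotient x y}
    {γ' : Path.Homotopic.Quotient y z} (h : IsDual hn γ) (h' : IsDual hn γ') :
    IsDual hn (γ.trans γ') := by
  intro s a t b hx hy
  obtain ⟨u, c, rfl⟩ := exists_pt_eq y
  subst hx hy
  obtain ⟨φ, hφ⟩ := h s a u c rfl rfl
  obtain ⟨ψ, hψ⟩ := h' u c t b rfl rfl
  refine ⟨φ.append ψ, ?_⟩
  rw [FacetPath.mk_dualPath_append, hφ, hψ]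
  simp only [Path.Homotopic.Quotient.cast_rfl_rfl, Path.Homotopic.Quotient.trans_assoc]
  rw [← Path.Homotopic.Quotient.trans_assoc (T.hub hn u c).symm,
    Path.Homotopic.Quotient.symm_trans, Path.Homotopic.Quotient.refl_trans]

lemma IsDual.of_cast {hn : 3 ≤ n} {x y x' y' : T.Punctured} {γ : Path.Homotopic.Quotient x y}
    {hx : x' = x} {hy : y' = y} (h : IsDual hn (γ.cast hx hy)) : IsDual hn γ := by
  subst hx hy
  rwa [Path.Homotopic.Quotient.cast_rfl_rfl] at h

/-- Paths inside a star neighbourhood are homotopic to dual paths. -/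
lemma isDual_of_mem_star (hn : 3 ≤ n) {s₀ : ι} {a : Core n} {ε : ℝ} (hε : Separates a.1 ε)
    {x y : T.Punctured} (γ : Path x y) (hγ : ∀ r, (γ r).1 ∈ T.star s₀ a.1 ε) :
    IsDual hn (.mk γ) := by
  intro s b t b' hx hy
  subst hx hy
  obtain ⟨g, H⟩ := (proj_mem_star_iff hε).mp (γ.source ▸ hγ 0 : (T.pt s b).1 ∈ T.star s₀ a.1 ε)
  obtain ⟨g', H'⟩ := (proj_mem_star_iff hε).mp (γ.target ▸ hγ 1 : (T.pt t b').1 ∈ T.star s₀ a.1 ε)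
  have K := H.holonomy.symm
  have hZ : (g⁻¹ : Equiv.Perm (Fin (n + 1))) '' (g '' {j | a.1 j = 0}) = {j | a.1 j = 0} := by
    rw [Set.image_image]; simp
  -- Return from `s` to the simplex of the centre, then go out to `t`: a holonomy around the copy of
  -- the centre in `s`.
  have K' := K.trans (h := g') (u := t) (by rw [hZ]; exact H'.holonomy)
  have hZ' : g '' {j | a.1 j = 0} = {j | (a.relabel g).1 j = 0} := by
    ext j
    obtain ⟨j, rfl⟩ := g.surjective j
    have : (a.relabel g).1 (g j) = a.1 j := relabel_apply g a.1 j
    simp [this]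
  rw [hZ'] at K'
  have hr : (a.relabel g).relabel (g' * g⁻¹) = a.relabel g' := by
    refine Subtype.ext ?_
    change relabel (g' * g⁻¹) (relabel g a.1) = relabel g' a.1
    rw [← relabel_mul, inv_mul_cancel_right]
  have key : ∀ c, (a.relabel g).relabel (g' * g⁻¹) = c →
      ∃ (φ : T.FacetPath s t) (h : T.pt s (a.relabel g) = T.pt t c),
        Path.Homotopic.Quotient.mk (φ.dualPath hn)
          = (T.hub hn s (a.relabel g)).trans ((T.hub hn t c).symm.cast h rfl) := by
    rintro c rfl
    exact K'.exists_mk_dualPath hn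
  obtain ⟨φ, h, e⟩ := key _ hr
  refine ⟨φ, ?_⟩
  rw [e, Path.Homotopic.Quotient.cast_rfl_rfl, mk_eq_of_mem_star hε H H' γ hγ h,
    ← Path.Homotopic.Quotient.trans_assoc, hub_trans_line, Path.Homotopic.Quotient.trans_assoc,
    quotient_symm_cast_trans, hub_trans_line]

/-- All paths are homotopic to dual paths, up to joining their end points to barycentres. -/
lemma isDual (hn : 3 ≤ n) {x y : T.Punctured} (γ : Path x y) : IsDual hn (.mk γ) := by
  choose s a hsa using fun r => exists_pt_eq (γ r)
  choose ε hε using fun r => exists_separates (a r).1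
  let c : unitInterval → Set unitInterval := fun r => {u | (γ u).1 ∈ T.star (s r) (a r).1 (ε r)}
  have hc : ∀ r, IsOpen (c r) := fun r =>
    (isOpen_star (hε r)).preimage (continuous_subtype_val.comp γ.continuous)
  have hcov : Set.univ ⊆ ⋃ r, c r := fun r _ => Set.mem_iUnion.mpr ⟨r, by
    change (γ r).1 ∈ T.star (s r) (a r).1 (ε r)
    rw [← hsa r]
    exact proj_mem_star_self (hε r)⟩
  -- Compactness cuts the path into finitely many pieces, each inside one star.
  obtain ⟨t, h0, hmono, ⟨m, hm⟩, ht⟩ :=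
    exists_monotone_Icc_subset_open_cover_unitInterval hc hcov
  have key : ∀ k, IsDual hn (.mk (γ.subpath (t 0) (t k))) := by
    intro k
    induction k with
    | zero =>
      refine isDual_of_mem_star hn (s₀ := s (t 0)) (hε (t 0)) _ fun r => ?_
      rw [Path.subpath_self, Path.refl_apply, ← hsa]
      exact proj_mem_star_self (hε (t 0))
    | succ k ih =>
      obtain ⟨r, hr⟩ := ht k
      have h1 : IsDual hn (.mk (γ.subpath (t k) (t (k + 1)))) := by
        refine isDual_of_mem_star hn (s₀ := s r) (hε r) _ fun u => ?_
        have h2 : γ.subpath (t k) (t (k + 1)) u ∈ γ '' Set.Icc (t k) (t (k + 1)) := by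
          rw [← Path.range_subpath_of_le _ _ _ (hmono k.le_succ)]
          exact Set.mem_range_self u
        obtain ⟨v, hv, e⟩ := h2
        rw [← e]
        exact hr hv
      have h3 := ih.trans h1
      rw [← Path.Homotopic.Quotient.mk_trans] at h3
      rwa [Path.Homotopic.Quotient.eq.mpr
        ⟨Path.Homotopy.subpathTransSubpath γ (t 0) (t k) (t (k + 1))⟩] at h3
  have h1 := key m
  rw [h0, hm m le_rfl, Path.subpath_zero_one, Path.Homotopic.Quotient.mk_cast] at h1
  exact h1.of_cast

/-! ### Finiteness of the vertex set and generation by dual loops. -/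

/-- For the pigeonhole principle: a bound on `Set.ncard` is informative only for a finite set. -/
lemma finite_skeleton_zero [Finite ι] (T : SingularTriangulation n ι) :
    (T.skeleton 0).Finite := by
  refine (Set.finite_range fun x : ι × Fin (n + 1) =>
    T.proj ⟨x.1, stdSimplex.vertex x.2⟩).subset ?_
  intro x hx
  obtain ⟨s, a, rfl⟩ := exists_rep x
  obtain ⟨j, hj⟩ := proj_mem_skeleton_zero_iff.mp hx
  have ha : a = stdSimplex.vertex j := by
    ext i
    change a i = (Pi.single j 1 : Fin (n + 1) → ℝ) i
    by_cases hij : i = j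
    · rw [hij, hj, Pi.single_eq_same]
    · rw [Pi.single_eq_of_ne hij]
      have h1 := sum_eq_one a
      rw [← Finset.add_sum_erase _ _ (Finset.mem_univ j), hj, add_eq_left,
        Finset.sum_eq_zero_iff_of_nonneg fun k _ => stdSimplex.zero_le a k] at h1
      exact h1 i (Finset.mem_erase.mpr ⟨hij, Finset.mem_univ _⟩)
  exact ⟨(s, j), by rw [ha]⟩

/-- The dual graph carries the fundamental group. -/
lemma exists_loopClass_eq (hn : 3 ≤ n) {s : ι}
    (x : FundamentalGroup T.Punctured (T.center hn s)) :
    ∃ φ : T.FacetPath s s, φ.loopClass hn = x := by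
  obtain ⟨γ, rfl⟩ := Path.Homotopic.Quotient.mk_surjective x
  obtain ⟨φ, hφ⟩ := isDual hn γ s (Core.bary n hn) s (Core.bary n hn) rfl rfl
  refine ⟨φ, hφ.trans ?_⟩
  have h1 : T.hub hn s (Core.bary n hn) = .refl _ := by
    rw [hub, ← map_eq_line s (Path.Homotopic.Quotient.refl _)]
    rfl
  have h2 : ∀ {z : T.Punctured} (q : Path.Homotopic.Quotient z z),
      ((Path.Homotopic.Quotient.refl z).trans (q.cast rfl rfl)).trans
        (Path.Homotopic.Quotient.refl z).symm = q := fun q => by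
    rw [Path.Homotopic.Quotient.cast_rfl_rfl]
    exact (Path.Homotopic.Quotient.trans_refl _).trans (Path.Homotopic.Quotient.refl_trans _)
  rw [h1]
  exact h2 _

end SingularTriangulation

end

/-! ### Conclusion. -/

theorem mainTheorem6 {n : ℕ} (hn : 3 ≤ n) {ι : Type*} [Finite ι]
    (T : SingularTriangulation n ι) [ConnectedSpace T.Space] :
    (∀ (s : ι) (v v' : Fin (n + 1)),
      T.proj ⟨s, stdSimplex.vertex v⟩ = T.proj ⟨s, stdSimplex.vertex v'⟩ →
        ∃ γ : T.FacetPath s s, γ.IsReduced ∧ γ.projectivity v = v') ∧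
    (T.IsEven →
      (4 ≤ n → T.InjectiveOnInteriors ∧ T.LinksSimplyConnected) →
      (T.skeleton 0).ncard < n + 1 →
      ∀ s : ι,
        (∃! ρ : FundamentalGroup T.Punctured (T.center hn s) →* Equiv.Perm (Fin (n + 1)),
          T.IsCanonicalRepresentation hn s ρ) ∧
        (∀ ρ : FundamentalGroup T.Punctured (T.center hn s) →* Equiv.Perm (Fin (n + 1)),
          T.IsCanonicalRepresentation hn s ρ → ρ.range ≠ ⊥) ∧
        Nontrivial (FundamentalGroup T.Punctured (T.center hn s))) := by
  refine ⟨T.exists_isReduced_projectivity_eq, fun heven hlinks hcard s => ?_⟩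
  obtain ⟨ρ₀, hρ₀⟩ := T.exists_isCanonicalRepresentation hn
    (T.locallyTrivial_of_isEven hn heven hlinks) s
  have hnontriv : ∀ ρ : FundamentalGroup T.Punctured (T.center hn s) →* Equiv.Perm (Fin (n + 1)),
      T.IsCanonicalRepresentation hn s ρ → ρ.range ≠ ⊥ := by
    intro ρ hρ hbot
    have hmaps : ∀ v ∈ (Set.univ : Set (Fin (n + 1))),
        T.proj ⟨s, stdSimplex.vertex v⟩ ∈ T.skeleton 0 := fun v _ =>
      SingularTriangulation.proj_mem_skeleton_zero_iff.mpr ⟨v, Pi.single_eq_same v 1⟩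
    -- Pigeonhole on the `n + 1` vertices of `s`; the loop given by part (1) moves `v` to `v' ≠ v`.
    obtain ⟨v, -, v', -, hne, he⟩ := Set.exists_ne_map_eq_of_ncard_lt_of_maps_to
      (by rwa [Set.ncard_univ, Nat.card_fin]) hmaps T.finite_skeleton_zero
    obtain ⟨γ, -, hγ⟩ := T.exists_isReduced_projectivity_eq s v v' he
    have h1 : ρ (γ.loopClass hn) ∈ ρ.range := ⟨_, rfl⟩
    rw [hbot, Subgroup.mem_bot, hρ γ] at h1
    rw [h1] at hγ
    exact hne hγ
  refine ⟨⟨ρ₀, hρ₀, fun ρ hρ => ?_⟩, hnontriv, ?_⟩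
  -- Every class is that of a dual loop, where both homomorphisms are prescribed.
  · ext1 x
    obtain ⟨γ, rfl⟩ := SingularTriangulation.exists_loopClass_eq hn x
    rw [hρ γ, hρ₀ γ]
  · by_contra hsub
    rw [not_nontrivial_iff_subsingleton] at hsub
    refine hnontriv ρ₀ hρ₀ ((Subgroup.eq_bot_iff_forall _).mpr ?_)
    rintro _ ⟨x, rfl⟩
    rw [Subsingleton.elim x 1, map_one]
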